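/- Let $p$ be an odd prime and let $K$ be a finite extension of $\mathbb{Q}_p$, with normalised valuation $v_K$. Let $f\in K[x]$ be a monic irreducible polynomial of degree $p$ whose discriminant $\Delta$ satisfies $\gcd(v_K(\Delta),p-1)=1$, and let $X/K$ be the complete hyperelliptic curve $y^2=f(x)$. (That $X$ has potentially good reduction is automatic here and need not be assumed.) Let $\alpha_1,\dots,\alpha_p\in\overline K$ be the roots of $f$, numbered so that $\alpha_1,\alpha_2$ are any two distinct roots, fix a square root $\sqrt{\alpha_2-\alpha_1}\in\overline K$, and put $F=K(\alpha_1,\dots,\alpha_p,\sqrt{\alpha_2-\alpha_1})$, with ring of integers $\mathcal{O}_F$. Then the residue field of $F$ is equal to the residue field $k$ of $K$, and there is a monic polynomial $g\in\mathcal{O}_F[x]$ of degree $p$, with reduction $x^p-x\in k[x]$, such that the complete curve $\mathcal{X}: y^2=g(x)$ over $\mathcal{O}_F$ (the affine curves $y^2=g(x)$ and $v^2=u^{p+1}g(1/u)$ glued along $xu=1$, $v=y/x^{(p+1)/2}$) is an integral model of $X\times_K F$: it is proper and flat over $\mathcal{O}_F$, and there is an isomorphism over $F$ of its generic fibre with $X\times_K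 F$, given on the affine charts by the substitution $$x\mapsto(\alpha_2-\alpha_1)\,x+\alpha_1,\qquad y\mapsto\sqrt{\alpha_2-\alpha_1}^{\,p}\,y.$$ Its special fibre is isomorphic over $k$ to the complete curve $y^2=x^p-x$. -/

import Mathlib

open Polynomial CategoryTheory CategoryTheory.Limits AlgebraicGeometry

universe u

noncomputable section

namespace PadicField

variable (p : ℕ) [Fact p.Prime]

/-- The structure map from the `p`-adic integers to a field extension `E` of `ℚ_p`. -/
def intMap (E : Type u) [Field E] [Algebra ℚ_[p] E] : ℤ_[p] →+* E :=
  (algebraMap ℚ_[p] E).comp (algebraMap ℤ_[p] ℚ_[p])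

section
variable {p} {E : Type u} [Field E] [Algebra ℚ_[p] E] [Algebra.IsAlgebraic ℚ_[p] E]

theorem isIntegralElem_of_spectralNorm_le_one {x : E} (hx : spectralNorm ℚ_[p] E x ≤ 1) :
    (intMap p E).IsIntegralElem x := by
  have hint : IsIntegral ℚ_[p] x := Algebra.IsIntegral.isIntegral x
  have hm := minpoly.monic hint
  have hc := (spectralValue_le_one_iff hm).1 hx
  have hl : minpoly ℚ_[p] x ∈ Polynomial.lifts (algebraMap ℤ_[p] ℚ_[p]) := by
    rw [Polynomial.lifts_iff_coeff_lifts]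
    exact fun n ↦ ⟨⟨_, hc n⟩, rfl⟩
  obtain ⟨q, hq, -, hqm⟩ := Polynomial.lifts_and_natDegree_eq_and_monic hl hm
  refine ⟨q, hqm, ?_⟩
  rw [intMap, ← Polynomial.eval₂_map, hq]
  exact minpoly.aeval _ _

/-- The ring of integers of an algebraic extension `E` of `ℚ_p`: the elements of `E` that are
integral over `ℤ_p`. It is a valuation ring. -/
def integers (p : ℕ) [Fact p.Prime] (E : Type u) [Field E] [Algebra ℚ_[p] E]
    [Algebra.IsAlgebraic ℚ_[p] E] : ValuationSubring E where
  carrier := {x | (intMap p E).IsIntegralElem x}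
  mul_mem' := fun hx hy ↦ RingHom.IsIntegralElem.mul _ hx hy
  one_mem' := RingHom.isIntegralElem_one _
  add_mem' := fun hx hy ↦ RingHom.IsIntegralElem.add _ hx hy
  zero_mem' := RingHom.isIntegralElem_zero _
  neg_mem' := fun hx ↦ RingHom.IsIntegralElem.neg _ hx
  mem_or_inv_mem' := fun x ↦ by
    by_cases hx : x = 0
    · left
      subst hx
      exact RingHom.isIntegralElem_zero _
    have h : spectralNorm ℚ_[p] E x * spectralNorm ℚ_[p] E x⁻¹ = 1 := by
      have := map_mul (spectralMulAlgNorm ℚ_[p] E) x x⁻¹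
      rw [mul_inv_cancel₀ hx, map_one] at this
      exact this.symm
    rcases le_total (spectralNorm ℚ_[p] E x) 1 with h1 | h1
    · exact Or.inl (isIntegralElem_of_spectralNorm_le_one h1)
    · refine Or.inr (isIntegralElem_of_spectralNorm_le_one ?_)
      have h0 := spectralNorm_nonneg (K := ℚ_[p]) (L := E) x⁻¹
      nlinarith

end

section
variable (K : Type u) [Field K] [Algebra ℚ_[p] K] [FiniteDimensional ℚ_[p] K]

theorem integers_isNoetherianRing : IsNoetherianRing (integers p K) := by
  let _ : Algebra ℤ_[p] K := (intMap p K).toAlgebra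
  have : IsScalarTower ℤ_[p] ℚ_[p] K := IsScalarTower.of_algebraMap_eq fun _ ↦ rfl
  have := IsIntegralClosure.isNoetherianRing ℤ_[p] ℚ_[p] K (integralClosure ℤ_[p] K)
  exact isNoetherianRing_of_ringEquiv (integralClosure ℤ_[p] K)
    (RingEquiv.subringCongr (R := K) (s := (integralClosure ℤ_[p] K).toSubring)
      (t := (integers p K).toSubring) (by ext; rfl))

theorem integers_not_isField : ¬ IsField (integers p K) := by
  intro h
  let _ : Algebra ℤ_[p] K := (intMap p K).toAlgebra
  have : IsScalarTower ℤ_[p] ℚ_[p] K := IsScalarTower.of_algebraMap_eq fun _ ↦ rfl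
  have hmem : ∀ a : ℤ_[p], algebraMap ℤ_[p] K a ∈ integers p K :=
    fun a ↦ RingHom.isIntegralElem_map _
  have hp0 : (p : K) ≠ 0 := by
    rw [← map_natCast (algebraMap ℚ_[p] K)]
    refine (_root_.map_ne_zero _).2 ?_
    exact_mod_cast (Fact.out : p.Prime).ne_zero
  have hpm : (p : K) ∈ integers p K := by simpa only [map_natCast] using hmem p
  obtain ⟨b, hb⟩ := h.mul_inv_cancel (a := (⟨p, hpm⟩ : integers p K))
    (fun h0 ↦ hp0 (congrArg Subtype.val h0))
  have hb' : (p : K) * (b : K) = 1 := congrArg Subtype.val hb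
  have hbi : IsIntegral ℤ_[p] (b : K) := b.2
  have hbe : (b : K) = algebraMap ℚ_[p] K (p : ℚ_[p])⁻¹ := by
    rw [map_inv₀, map_natCast]
    exact eq_inv_of_mul_eq_one_right hb'
  rw [hbe, isIntegral_algebraMap_iff (algebraMap ℚ_[p] K).injective] at hbi
  obtain ⟨c, hc⟩ := IsIntegrallyClosed.isIntegral_iff.1 hbi
  have := c.2
  have hcv : (c : ℚ_[p]) = (p : ℚ_[p])⁻¹ := hc
  rw [hcv, norm_inv, Padic.norm_p, inv_inv] at this
  have h2 : (2 : ℝ) ≤ p := by exact_mod_cast (Fact.out : p.Prime).two_le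
  linarith

instance : IsDiscreteValuationRing (integers p K) :=
  have : IsNoetherianRing (integers p K) := integers_isNoetherianRing p K
  have h : ValuationRing (integers p K) := inferInstance
  ((IsDiscreteValuationRing.TFAE (integers p K) (integers_not_isField p K)).out 0 1).2 h

/-- The normalised valuation `v_K : Kˣ → ℤ` of a finite extension `K` of `ℚ_p`, taking the value
`1` at a uniformiser (with the junk value `0` at `0`). -/
def normalizedVal (x : K) : ℤ :=
  - WithZero.log ((IsDiscreteValuationRing.maximalIdeal (integers p K)).valuation K x)

end

section
variable (K L : Type u) [Field K] [Algebra ℚ_[p] K] [Algebra.IsAlgebraic ℚ_[p] K]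
  [Field L] [Algebra ℚ_[p] L] [Algebra.IsAlgebraic ℚ_[p] L] [Algebra K L]
  [IsScalarTower ℚ_[p] K L]

/-- The inclusion `𝒪_K → 𝒪_L` for an extension `L/K` of algebraic extensions of `ℚ_p`. -/
def integersMap : integers p K →+* integers p L :=
  ((algebraMap K L).comp (integers p K).subtype).codRestrict (integers p L) fun x ↦ by
    obtain ⟨q, hq, hx⟩ := x.2
    refine ⟨q, hq, ?_⟩
    have h := Polynomial.hom_eval₂ q (intMap p K) (algebraMap K L) x.1
    rw [hx, map_zero] at h
    have hc : (algebraMap K L).comp (intMap p K) = intMap p L := by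
      ext a
      simp [intMap, IsScalarTower.algebraMap_apply ℚ_[p] K L]
    rw [hc] at h
    exact h.symm

instance : IsLocalHom (integersMap p K L) where
  map_nonunit a ha := by
    have ha0 : (a : K) ≠ 0 := by
      intro h
      have : a = 0 := Subtype.ext h
      subst this
      simp at ha
    obtain ⟨b, hb⟩ := ha.exists_right_inv
    have hb' : algebraMap K L a * (b : L) = 1 := congrArg Subtype.val hb
    have hbe : (b : L) = algebraMap K L (a : K)⁻¹ := by
      rw [map_inv₀]
      exact eq_inv_of_mul_eq_one_right hb'
    have hmem : (a : K)⁻¹ ∈ integers p K := by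
      obtain ⟨q, hq, hx⟩ := b.2
      refine ⟨q, hq, ?_⟩
      apply (algebraMap K L).injective
      have hc : (algebraMap K L).comp (intMap p K) = intMap p L := by
        ext a
        simp [intMap, IsScalarTower.algebraMap_apply ℚ_[p] K L]
      rw [Polynomial.hom_eval₂, hc, map_zero, ← hbe]
      exact hx
    exact IsUnit.of_mul_eq_one ⟨_, hmem⟩ (Subtype.ext (mul_inv_cancel₀ ha0))

/-- The residue field of an algebraic extension of `ℚ_p`. -/
abbrev residueField := IsLocalRing.ResidueField (integers p K)

/-- The extension of residue fields. -/
def residueFieldMap : residueField p K →+* residueField p L :=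
  IsLocalRing.ResidueField.map (integersMap p K L)
end

section
variable (K : Type u) [Field K] [Algebra ℚ_[p] K] [FiniteDimensional ℚ_[p] K]

instance isAlgebraic_algebraicClosure : Algebra.IsAlgebraic ℚ_[p] (AlgebraicClosure K) :=
  .trans ℚ_[p] K (AlgebraicClosure K)

instance isAlgebraic_intermediateField (F : IntermediateField K (AlgebraicClosure K)) :
    Algebra.IsAlgebraic ℚ_[p] F :=
  .trans ℚ_[p] K F
end

section
variable {K : Type u} [Field K]

/-- The subfield of the algebraic closure of `K` generated over `K` by all roots of `f` and by the
element `s` (a square root of the difference of two roots, in the application). -/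
def rootField (f : K[X]) (s : AlgebraicClosure K) : IntermediateField K (AlgebraicClosure K) :=
  IntermediateField.adjoin K (f.rootSet (AlgebraicClosure K) ∪ {s})

theorem mem_rootField_of_mem_rootSet {f : K[X]} {s α : AlgebraicClosure K}
    (h : α ∈ f.rootSet (AlgebraicClosure K)) : α ∈ rootField f s :=
  IntermediateField.subset_adjoin _ _ (Or.inl h)

theorem mem_rootField_self (f : K[X]) (s : AlgebraicClosure K) : s ∈ rootField f s :=
  IntermediateField.subset_adjoin _ _ (Or.inr rfl)
end

end PadicField

namespace Hyperelliptic

variable {R : Type u} [CommRing R]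

/-- The coordinate ring `R[x, y] / (y² - g(x))`. -/
abbrev CoordRing (g : R[X]) : Type u := AdjoinRoot (X ^ 2 - C g : R[X][X])

/-- The coordinate function `x`. -/
def coordX (g : R[X]) : CoordRing g := AdjoinRoot.of _ X

/-- The coordinate function `y`. -/
def coordY (g : R[X]) : CoordRing g := AdjoinRoot.root _

theorem eval₂_coordX (g : R[X]) :
    g.eval₂ (algebraMap R (CoordRing g)) (coordX g) = AdjoinRoot.of _ g := by
  have h := Polynomial.hom_eval₂ g (C : R →+* R[X]) (AdjoinRoot.of (X ^ 2 - C g : R[X][X])) X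
  rw [Polynomial.eval₂_C_X] at h
  exact h.symm

theorem coordY_sq (g : R[X]) :
    coordY g ^ 2 = g.eval₂ (algebraMap R (CoordRing g)) (coordX g) := by
  rw [eval₂_coordX]
  have h := AdjoinRoot.eval₂_root (X ^ 2 - C g : R[X][X])
  rw [eval₂_sub, eval₂_pow, eval₂_X, eval₂_C, sub_eq_zero] at h
  exact h

/-- The ring homomorphism out of the coordinate ring that extends `i` and sends `x`, `y` to a
given solution `a`, `b` of the equation. -/
def evalHom (g : R[X]) {S : Type u} [CommRing S] (i : R →+* S) (a b : S)
    (h : b ^ 2 = g.eval₂ i a) : CoordRing g →+* S :=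
  AdjoinRoot.lift (Polynomial.eval₂RingHom i a) b (by simp [h])

section
variable (g : R[X]) {S : Type u} [CommRing S] (i : R →+* S) (a b : S) (h : b ^ 2 = g.eval₂ i a)

@[simp] theorem evalHom_coordX : evalHom g i a b h (coordX g) = a := by
  simp [evalHom, coordX]

@[simp] theorem evalHom_coordY : evalHom g i a b h (coordY g) = b := by
  simp [evalHom, coordY]

@[simp] theorem evalHom_algebraMap (r : R) :
    evalHom g i a b h (algebraMap R (CoordRing g) r) = i r := by
  have : algebraMap R (CoordRing g) r = AdjoinRoot.of _ (C r) := rfl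
  rw [this]
  simp [evalHom]
end

theorem coordRing_hom_ext {g : R[X]} {S : Type u} [CommRing S] {φ ψ : CoordRing g →+* S}
    (h : φ.comp (algebraMap R (CoordRing g)) = ψ.comp (algebraMap R (CoordRing g)))
    (hx : φ (coordX g) = ψ (coordX g)) (hy : φ (coordY g) = ψ (coordY g)) : φ = ψ := by
  refine AdjoinRoot.ringHom_ext (Polynomial.ringHom_ext' ?_ hx) hy
  ext r
  exact congrArg (fun f ↦ f r) h

/-- The coordinate ring of the overlap of the two charts, obtained by inverting `x`. -/
abbrev OverlapRing (g : R[X]) : Type u := Localization.Away (coordX g)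

/-- The inverse of `x` on the overlap. -/
def invX (g : R[X]) : OverlapRing g := IsLocalization.Away.invSelf (coordX g)

theorem coordX_mul_invX (g : R[X]) : algebraMap (CoordRing g) (OverlapRing g) (coordX g) * invX g = 1 :=
  IsLocalization.Away.mul_invSelf _

theorem transition_eq (g : R[X]) (n : ℕ) (hg : g.natDegree ≤ 2 * n + 2) :
    (algebraMap (CoordRing g) (OverlapRing g) (coordY g) * invX g ^ (n + 1)) ^ 2 =
      (g.reflect (2 * n + 2)).eval₂ (algebraMap R (OverlapRing g)) (invX g) := by
  let _ : Invertible (algebraMap (CoordRing g) (OverlapRing g) (coordX g)) :=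
    ⟨invX g, by rw [mul_comm]; exact coordX_mul_invX g, coordX_mul_invX g⟩
  have h := Polynomial.eval₂_reflect_mul_pow (algebraMap R (OverlapRing g))
    (algebraMap (CoordRing g) (OverlapRing g) (coordX g)) (2 * n + 2) g hg
  have h2 : g.eval₂ (algebraMap R (OverlapRing g))
      (algebraMap (CoordRing g) (OverlapRing g) (coordX g)) =
      algebraMap (CoordRing g) (OverlapRing g) (coordY g) ^ 2 := by
    rw [← map_pow, coordY_sq, Polynomial.hom_eval₂]
    rfl
  rw [h2] at h
  rw [mul_pow, ← h]
  have h3 : algebraMap (CoordRing g) (OverlapRing g) (coordX g) ^ (2 * n + 2) *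
    (invX g ^ (n + 1)) ^ 2 = 1 := by
    rw [← pow_mul, show (n + 1) * 2 = 2 * n + 2 by ring, ← mul_pow, coordX_mul_invX, one_pow]
  rw [mul_assoc, h3, mul_one]
  rfl

/-- The transition map `u ↦ 1 / x`, `v ↦ y / x ^ (n + 1)` from the coordinate ring of the chart
at infinity `v² = u ^ (2 n + 2) g(1 / u)` to the coordinate ring of the overlap. -/
def transition (g h : R[X]) (n : ℕ) (hg : g.natDegree ≤ 2 * n + 2)
    (hh : h = g.reflect (2 * n + 2)) : CoordRing h →+* OverlapRing g :=
  evalHom h (algebraMap R (OverlapRing g)) (invX g)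
    (algebraMap (CoordRing g) (OverlapRing g) (coordY g) * invX g ^ (n + 1))
    (by rw [hh]; exact transition_eq g n hg)

section
variable (g h : R[X]) (n : ℕ) (hg : g.natDegree ≤ 2 * n + 2) (hh : h = g.reflect (2 * n + 2))

theorem isUnit_transition_coordX : IsUnit (transition g h n hg hh (coordX h)) := by
  rw [transition, evalHom_coordX]
  exact IsUnit.of_mul_eq_one _ ((mul_comm _ _).trans (coordX_mul_invX g))

/-- The transition map, extended to the overlap. -/
def transitionLift : OverlapRing h →+* OverlapRing g :=
  IsLocalization.Away.lift (coordX h) (isUnit_transition_coordX g h n hg hh)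

theorem transitionLift_comp_algebraMap :
    (transitionLift g h n hg hh).comp (algebraMap (CoordRing h) (OverlapRing h)) =
      transition g h n hg hh :=
  IsLocalization.Away.lift_comp _ _

theorem transitionLift_algebraMap (a : CoordRing h) :
    transitionLift g h n hg hh (algebraMap (CoordRing h) (OverlapRing h) a) =
      transition g h n hg hh a :=
  IsLocalization.Away.lift_eq _ _ _

theorem transitionLift_invX :
    transitionLift g h n hg hh (invX h) = algebraMap (CoordRing g) (OverlapRing g) (coordX g) := by
  have h1 := congrArg (transitionLift g h n hg hh) (coordX_mul_invX h)
  rw [map_mul, map_one, transitionLift_algebraMap, transition, evalHom_coordX] at h1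
  calc _ = (algebraMap (CoordRing g) (OverlapRing g) (coordX g) * invX g) *
        transitionLift g h n hg hh (invX h) := by rw [coordX_mul_invX, one_mul]
    _ = _ := by rw [mul_assoc, h1, mul_one]

theorem reflect_bound (g h : R[X]) (n : ℕ) (hg : g.natDegree ≤ 2 * n + 2)
    (hh : h = g.reflect (2 * n + 2)) : h.natDegree ≤ 2 * n + 2 := by
  rw [hh]
  exact natDegree_reflect_le.trans (by simpa using hg)

theorem reflect_symm (g h : R[X]) (n : ℕ) (hh : h = g.reflect (2 * n + 2)) : g = h.reflect (2 * n + 2) := by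
  rw [hh]
  ext i
  simp

theorem transitionLift_comp :
    (transitionLift g h n hg hh).comp (transitionLift h g n (reflect_bound g h n hg hh)
      (reflect_symm g h n hh)) = RingHom.id _ := by
  refine IsLocalization.ringHom_ext (Submonoid.powers (coordX g)) ?_
  rw [RingHom.comp_assoc, transitionLift_comp_algebraMap]
  refine coordRing_hom_ext ?_ ?_ ?_
  · ext r
    have h1 : algebraMap R (OverlapRing h) r =
      algebraMap (CoordRing h) (OverlapRing h) (algebraMap R (CoordRing h) r) := rfl
    simp only [RingHom.comp_apply, transition, evalHom_algebraMap]
    rw [h1, transitionLift_algebraMap, transition, evalHom_algebraMap]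
    rfl
  · simp only [RingHom.comp_apply, transition, evalHom_coordX]
    rw [transitionLift_invX]
    rfl
  · simp only [RingHom.comp_apply, transition, evalHom_coordY, map_mul, map_pow]
    rw [transitionLift_invX, transitionLift_algebraMap, transition, evalHom_coordY, mul_assoc,
      ← mul_pow, mul_comm (invX g), coordX_mul_invX, one_pow, mul_one]
    rfl

/-- The two descriptions of the overlap agree. -/
def transitionEquiv : OverlapRing h ≃+* OverlapRing g :=
  RingEquiv.ofRingHom (transitionLift g h n hg hh)
    (transitionLift h g n (reflect_bound g h n hg hh) (reflect_symm g h n hh))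
    (transitionLift_comp g h n hg hh)
    (by
      have := transitionLift_comp h g n (reflect_bound g h n hg hh) (reflect_symm g h n hh)
      exact this)

instance isOpenImmersion_transition :
    IsOpenImmersion (Spec.map (CommRingCat.ofHom (transition g h n hg hh))) := by
  have h1 : CommRingCat.ofHom (transition g h n hg hh) =
      CommRingCat.ofHom (algebraMap (CoordRing h) (OverlapRing h)) ≫
        (transitionEquiv g h n hg hh).toCommRingCatIso.hom := by
    rw [← transitionLift_comp_algebraMap]
    rfl
  rw [h1, Spec.map_comp]
  infer_instance

end

/-- The genus of a hyperelliptic curve `y² = g(x)`; here `2 g + 1` or `2 g + 2` is the degree. -/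
def genus (g : R[X]) : ℕ := (g.natDegree - 1) / 2

theorem natDegree_le_genus (g : R[X]) : g.natDegree ≤ 2 * genus g + 2 := by
  unfold genus
  lia

/-- The polynomial `u ^ (2 n + 2) g(1 / u)`, `n` the genus, that defines the chart at infinity. -/
def atInfinity (g : R[X]) : R[X] := g.reflect (2 * genus g + 2)

/-- The affine chart `Spec R[x, y] / (y² - g(x))`. -/
abbrev affineChart (g : R[X]) : Scheme.{u} := Spec (CommRingCat.of (CoordRing g))

/-- The open subscheme `x ≠ 0` of the affine chart. -/
abbrev overlap (g : R[X]) : Scheme.{u} := Spec (CommRingCat.of (OverlapRing g))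

/-- The inclusion of the overlap into the affine chart. -/
abbrev overlapToAffine (g : R[X]) : overlap g ⟶ affineChart g :=
  Spec.map (CommRingCat.ofHom (algebraMap (CoordRing g) (OverlapRing g)))

/-- The inclusion of the overlap into the chart at infinity, `u = 1 / x`, `v = y / x ^ (n + 1)`. -/
abbrev overlapToInfinity (g : R[X]) : overlap g ⟶ affineChart (atInfinity g) :=
  Spec.map (CommRingCat.ofHom (transition g (atInfinity g) (genus g) (natDegree_le_genus g) rfl))

instance (g : R[X]) : IsOpenImmersion (overlapToAffine g) :=
  IsOpenImmersion.of_isLocalization (coordX g)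

instance (g : R[X]) : IsOpenImmersion (overlapToInfinity g) :=
  isOpenImmersion_transition g (atInfinity g) (genus g) (natDegree_le_genus g) rfl

/-- The complete curve `y² = g(x)` over `R`: the affine curves `y² = g(x)` and
`v² = u ^ (2 n + 2) g(1 / u)` glued along `x u = 1`, `v = y / x ^ (n + 1)`. -/
def curve (g : R[X]) : Scheme.{u} := pushout (overlapToAffine g) (overlapToInfinity g)

/-- The inclusion of the affine chart. -/
def affineInclusion (g : R[X]) : affineChart g ⟶ curve g :=
  pushout.inl (overlapToAffine g) (overlapToInfinity g)

/-- The structure morphism of the complete curve. -/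
def curveStr (g : R[X]) : curve g ⟶ Spec (CommRingCat.of R) :=
  pushout.desc (Spec.map (CommRingCat.ofHom (algebraMap R (CoordRing g))))
    (Spec.map (CommRingCat.ofHom (algebraMap R (CoordRing (atInfinity g))))) (by
      rw [← Spec.map_comp, ← Spec.map_comp, ← CommRingCat.ofHom_comp, ← CommRingCat.ofHom_comp]
      congr 2
      ext r
      simp only [RingHom.comp_apply, transition, evalHom_algebraMap]
      rfl)

theorem affineInclusion_curveStr (g : R[X]) : affineInclusion g ≫ curveStr g =
    Spec.map (CommRingCat.ofHom (algebraMap R (CoordRing g))) :=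
  pushout.inl_desc _ _ _

section
variable {S : Type u} [CommRing S] (φ : R →+* S) (g : R[X])

/-- The base change of the complete curve along `φ : R → S`. -/
abbrev baseChange : Scheme.{u} := pullback (curveStr g) (Spec.map (CommRingCat.ofHom φ))

/-- The structure morphism of the base change. -/
abbrev baseChangeStr : baseChange φ g ⟶ Spec (CommRingCat.of S) :=
  pullback.snd (curveStr g) (Spec.map (CommRingCat.ofHom φ))

/-- The map of coordinate rings induced by `φ`. -/
def coordRingMap : CoordRing g →+* CoordRing (g.map φ) :=
  evalHom g ((algebraMap S (CoordRing (g.map φ))).comp φ) (coordX _) (coordY _) (by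
    rw [coordY_sq, Polynomial.eval₂_map])

/-- The affine chart `y² = (φ g)(x)` over `S`, as an open subscheme of the base change to `S` of
the complete curve `y² = g(x)`. -/
def affineToBaseChange : affineChart (g.map φ) ⟶ baseChange φ g :=
  pullback.lift (Spec.map (CommRingCat.ofHom (coordRingMap φ g)) ≫ affineInclusion g)
    (Spec.map (CommRingCat.ofHom (algebraMap S (CoordRing (g.map φ))))) (by
      rw [Category.assoc, affineInclusion_curveStr, ← Spec.map_comp, ← Spec.map_comp,
        ← CommRingCat.ofHom_comp, ← CommRingCat.ofHom_comp]
      congr 2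
      ext r
      simp only [RingHom.comp_apply, coordRingMap, evalHom_algebraMap])
end

/-- An integral model over `R` (a discrete valuation ring with field of fractions `F`, embedded
by `ι`) of a proper scheme `πX : X ⟶ Spec F`: a proper flat `R`-scheme `π : Y ⟶ Spec R` together
with an isomorphism of its generic fibre with `X` over `F`. -/
structure IntegralModel {F : Type u} [Field F] (ι : R →+* F) {X Y : Scheme.{u}}
    (πX : X ⟶ Spec (CommRingCat.of F)) (π : Y ⟶ Spec (CommRingCat.of R)) where
  isProper : IsProper π
  flat : Flat π
  /-- The identification of the generic fibre. -/
  genericIso : pullback π (Spec.map (CommRingCat.ofHom ι)) ≅ X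
  genericIso_str : genericIso.hom ≫ πX = pullback.snd π (Spec.map (CommRingCat.ofHom ι))

end Hyperelliptic

end

/-! Arithmetic. Let L be the splitting field of f inside F and G = Gal(L/K). Since G is transitive
on the p roots, it contains an element of order p, which permutes them in one cycle. Along such a
cycle a difference of two roots is a sum of conjugates of any other one, and conjugates have equal
valuation, so all differences of roots have the same valuation (`root_sub_div_mem`). Hence v_L(Δ) =
p(p-1) v_L(α₂ - α₁) (`normalizedVal_discr`). Comparing with v_L(Δ) = e(L/K) v_K(Δ) gives p-1 ∣
e(L/K). As p ≥ 3, inertia is non-trivial; being normal in a faithful transitive group of prime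
degree, it has order divisible by p. So it contains some σ of order p with σα₁ = α₂
(`exists_mem_inertia_of_isCoprime`).

Put δ = σα₁ - α₁. Inertia acts trivially on residues, so σⁱδ/δ reduces to the i-th power of a p-th
root of unity in characteristic p, that is, to 1. Therefore (σʲα₁ - α₁)/δ, the sum of σⁱδ/δ over i <
j, reduces to j, and the monic polynomial g with these roots reduces to ∏(x - j) = x^p - x. The same
residues show that an automorphism of L/K fixing α₁ and α₂ is trivial, so |G| ≤ p(p-1) and [F:K] ≤
2p(p-1). With s² = α₂ - α₁ one has v_F(Δ) = 2p(p-1) v_F(s), and v_K(Δ) is prime to 2(p-1) because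
p-1 is even; so 2(p-1) and p both divide e(F/K), and F/K is totally ramified
(`exists_normalizedPoly`).

Geometry. The complete curve over any ring is flat and proper: its coordinate rings are free over
R[x], and properness is the valuative criterion applied to x or 1/x. Its formation commutes with
base change when the genus is preserved (`curveIsoBaseChange`), which handles both fibres. Over F
the substitution relating f to g extends to an isomorphism of complete curves
(`exists_substitutionIso`). -/

noncomputable section

namespace AlgebraicGeometry

/-! ### Schemes glued from two open subschemes -/

section TwoOpens

variable {W U V X S : Scheme.{u}} {f : W ⟶ U} {g : W ⟶ V} {i : U ⟶ X} {j : V ⟶ X}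

/-- The open cover of a scheme by two open immersions that are jointly surjective. -/
def twoOpenCover (i : U ⟶ X) (j : V ⟶ X) [IsOpenImmersion i] [IsOpenImmersion j]
    (hc : Set.range i ∪ Set.range j = Set.univ) : X.OpenCover :=
  Scheme.Cover.mkOfCovers Bool (fun b ↦ cond b U V)
    (fun b ↦ match b with | true => i | false => j)
    (fun x ↦ by
      rcases hc.symm ▸ Set.mem_univ x with ⟨y, hy⟩ | ⟨y, hy⟩
      · exact ⟨true, y, hy⟩
      · exact ⟨false, y, hy⟩)
    (fun b ↦ match b with | true => ‹IsOpenImmersion i› | false => ‹IsOpenImmersion j›)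

theorem twoOpenCover_hom_ext [IsOpenImmersion i] [IsOpenImmersion j]
    (hc : Set.range i ∪ Set.range j = Set.univ) {T : Scheme.{u}} {a b : X ⟶ T}
    (h1 : i ≫ a = i ≫ b) (h2 : j ≫ a = j ≫ b) : a = b := by
  refine (twoOpenCover i j hc).hom_ext _ _ fun t ↦ ?_
  cases t
  · exact h2
  · exact h1

/-- A scheme is obtained by gluing two jointly surjective open subschemes along their
intersection. -/
theorem isPushout_of_isPullback [IsOpenImmersion i] [IsOpenImmersion j]
    (h : IsPullback f g i j) (hc : Set.range i ∪ Set.range j = Set.univ) :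
    IsPushout f g i j := by
  have key : ∀ s : PushoutCocone f g, ∃ l : X ⟶ s.pt, i ≫ l = s.inl ∧ j ≫ l = s.inr := by
    intro s
    have hij : pullback.fst i j ≫ s.inl = pullback.snd i j ≫ s.inr := by
      rw [← cancel_epi h.isoPullback.hom]
      simpa using s.condition
    let m : ∀ b, (twoOpenCover i j hc).X b ⟶ s.pt := fun b ↦
      match b with | true => s.inl | false => s.inr
    -- Only the mixed overlaps carry information; the overlap of a chart with itself is trivial
    -- because an open immersion is a monomorphism.
    have hm : ∀ x y, pullback.fst ((twoOpenCover i j hc).f x) ((twoOpenCover i j hc).f y) ≫ m x =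
        pullback.snd _ _ ≫ m y := by
      intro x y
      cases x <;> cases y
      · change pullback.fst j j ≫ s.inr = pullback.snd j j ≫ s.inr
        rw [fst_eq_snd_of_mono_eq]
      · change pullback.fst j i ≫ s.inr = pullback.snd j i ≫ s.inl
        rw [← cancel_epi (pullbackSymmetry i j).hom]
        simpa using hij.symm
      · exact hij
      · change pullback.fst i i ≫ s.inl = pullback.snd i i ≫ s.inl
        rw [fst_eq_snd_of_mono_eq]
    refine ⟨(twoOpenCover i j hc).glueMorphisms m hm, ?_, ?_⟩
    · exact (twoOpenCover i j hc).ι_glueMorphisms m hm true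
    · exact (twoOpenCover i j hc).ι_glueMorphisms m hm false
  refine ⟨h.toCommSq, ⟨PushoutCocone.IsColimit.mk _ (fun s ↦ (key s).choose)
    (fun s ↦ (key s).choose_spec.1) (fun s ↦ (key s).choose_spec.2) ?_⟩⟩
  intro s m h1 h2
  exact twoOpenCover_hom_ext hc (h1.trans (key s).choose_spec.1.symm)
    (h2.trans (key s).choose_spec.2.symm)

instance isOpenImmersion_pushout_inl [IsOpenImmersion f] [IsOpenImmersion g] :
    IsOpenImmersion (pushout.inl f g) :=
  inferInstanceAs (IsOpenImmersion (colimit.ι (span f g) WalkingSpan.left))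

instance isOpenImmersion_pushout_inr [IsOpenImmersion f] [IsOpenImmersion g] :
    IsOpenImmersion (pushout.inr f g) :=
  inferInstanceAs (IsOpenImmersion (colimit.ι (span f g) WalkingSpan.right))

theorem range_pushout_inl_union_range_pushout_inr (f : W ⟶ U) (g : W ⟶ V)
    [IsOpenImmersion f] [IsOpenImmersion g] :
    Set.range (pushout.inl f g) ∪ Set.range (pushout.inr f g) = Set.univ := by
  rw [Set.eq_univ_iff_forall]
  intro x
  obtain ⟨t, y, hy⟩ := Scheme.IsLocallyDirected.ι_jointly_surjective (span f g) x
  obtain (a | (a | a)) := t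
  · left
    have h := colimit.w (span f g) WalkingSpan.Hom.fst
    exact ⟨f y, (congrArg (fun t : W ⟶ pushout f g ↦ t y) h).trans hy⟩
  · exact Or.inl ⟨y, hy⟩
  · exact Or.inr ⟨y, hy⟩

/-- For open immersions it is enough to identify the preimage of one chart in the other as a set.
Points of the two charts are glued only when they come from a common object of the span. -/
theorem isPullback_pushout (f : W ⟶ U) (g : W ⟶ V) [IsOpenImmersion f] [IsOpenImmersion g] :
    IsPullback f g (pushout.inl f g) (pushout.inr f g) := by
  refine (IsOpenImmersion.isPullback g f _ _ pushout.condition ?_).flip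
  ext x
  constructor
  · rintro ⟨y, hy⟩
    obtain ⟨k, fi, fj, z, h1, h2⟩ := (Scheme.IsLocallyDirected.ι_eq_ι_iff (span f g)
      (i := WalkingSpan.right) (j := WalkingSpan.left) (xi := y) (xj := x)).1 hy
    -- Only the apex of the span has arrows to both legs.
    obtain (a | (a | a)) := k
    · refine ⟨z, ?_⟩
      rw [← h2, Subsingleton.elim fj WalkingSpan.Hom.fst]
      rfl
    · nomatch fi
    · nomatch fj
  · rintro ⟨y, rfl⟩
    refine ⟨g y, ?_⟩
    rw [← Scheme.Hom.comp_apply, ← Scheme.Hom.comp_apply, pushout.condition]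

/-- The base change of a scheme that is glued from two open subschemes. -/
theorem isPullback_of_baseChange {W' U' V' X' : Scheme.{u}} {f' : W' ⟶ U'} {g' : W' ⟶ V'}
    {i' : U' ⟶ X'} {j' : V' ⟶ X'} {w : W' ⟶ W} {a : U' ⟶ U} {b : V' ⟶ V} {q : X' ⟶ X}
    (h : IsPullback f g i j) (hW : IsPullback f' w a f) (hU : IsPullback i' a q i)
    (hV : IsPullback j' b q j) (hw : g' ≫ b = w ≫ g) (hij : f' ≫ i' = g' ≫ j') :
    IsPullback f' g' i' j' := by
  -- The outer rectangle over `X` is cartesian; cancelling the cartesian square of `V` from it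
  -- leaves the claim.
  have h1 := hW.paste_vert h
  rw [← hw, ← hU.w] at h1
  exact h1.of_bot hij hV

/-- The diagonal of `X` over `S`, restricted to the open subscheme `U ×_S V` of `X ×_S X`. -/
theorem isPullback_lift_diagonal (h : IsPullback f g i j) (π : X ⟶ S) :
    IsPullback (f ≫ i) (pullback.lift f g (by simp only [← Category.assoc, h.w]) :
        W ⟶ pullback (i ≫ π) (j ≫ π))
      (pullback.diagonal π) (pullback.map (i ≫ π) (j ≫ π) π π i j (𝟙 S) (by simp) (by simp)) := by
  refine ⟨⟨?_⟩, ⟨PullbackCone.IsLimit.mk _ (fun s ↦ h.lift (s.snd ≫ pullback.fst _ _)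
    (s.snd ≫ pullback.snd _ _) ?_) (fun s ↦ ?_) (fun s ↦ ?_) ?_⟩⟩
  · apply pullback.hom_ext <;> simp [h.w, pullback.map, pullback.lift_fst, pullback.lift_snd, pullback.lift_fst_assoc, pullback.lift_snd_assoc]
  · have h1 := s.condition =≫ pullback.fst _ _
    have h2 := s.condition =≫ pullback.snd _ _
    simp only [Category.assoc, pullback.diagonal_fst, pullback.diagonal_snd, pullback.lift_fst,
      pullback.lift_snd, pullback.map] at h1 h2
    simp only [Category.assoc]
    rw [← h1, ← h2]
  · have h1 := s.condition =≫ pullback.fst _ _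
    simp only [Category.assoc, pullback.diagonal_fst, pullback.lift_fst, pullback.map] at h1
    simp only [h.lift_fst_assoc, Category.assoc]
    exact h1.symm.trans (Category.comp_id _)
  · apply pullback.hom_ext <;> simp [pullback.lift_fst, pullback.lift_snd]
  · intro s m h1 h2
    apply h.hom_ext <;> simp [← h2, pullback.lift_fst, pullback.lift_snd]

/-- Being a closed immersion is local on the target, and X ×_S X is covered by four products of
charts. On U × U and V × V the diagonal of X restricts to the diagonals of U and V; on the mixed
products it restricts to the map from the overlap W. -/
theorem isSeparated_of_isClosedImmersion_lift [IsOpenImmersion i] [IsOpenImmersion j]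
    (h : IsPullback f g i j) (hc : Set.range i ∪ Set.range j = Set.univ) (π : X ⟶ S)
    [IsSeparated (i ≫ π)] [IsSeparated (j ≫ π)]
    (hcl : IsClosedImmersion (pullback.lift f g (by simp only [← Category.assoc, h.w]) :
      W ⟶ pullback (i ≫ π) (j ≫ π))) : IsSeparated π := by
  have key : ∀ {U₁ U₂ Z : Scheme.{u}} {a : U₁ ⟶ X} {b : U₂ ⟶ X} {z : Z ⟶ U₁} {z' : Z ⟶ U₂}
      (h : IsPullback z z' a b), IsClosedImmersion (pullback.lift z z' (by simp only [← Category.assoc, h.w]) :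
      Z ⟶ pullback (a ≫ π) (b ≫ π)) → IsClosedImmersion (pullback.snd (pullback.diagonal π)
        (pullback.map (a ≫ π) (b ≫ π) π π a b (𝟙 S) (by simp) (by simp))) := by
    intro U₁ U₂ Z a b z z' h h'
    have := (isPullback_lift_diagonal h π).isoPullback_inv_snd
    rw [← this]
    infer_instance
  have diag : ∀ {U₁ : Scheme.{u}} (a : U₁ ⟶ X) [IsOpenImmersion a] [IsSeparated (a ≫ π)],
      IsClosedImmersion (pullback.snd (pullback.diagonal π)
        (pullback.map (a ≫ π) (a ≫ π) π π a a (𝟙 S) (by simp) (by simp))) := by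
    intro U₁ a _ _
    refine key (IsKernelPair.id_of_mono a) ?_
    exact inferInstanceAs (IsClosedImmersion (pullback.diagonal (a ≫ π)))
  refine ⟨IsZariskiLocalAtTarget.of_openCover (Scheme.Pullback.openCoverOfLeftRight
    (twoOpenCover i j hc) (twoOpenCover i j hc) π π) ?_⟩
  rintro ⟨x, y⟩
  cases x <;> cases y
  · exact diag j
  · refine key h.flip ?_
    have : (pullback.lift g f (by simp only [← Category.assoc, h.w]) :
        W ⟶ pullback (j ≫ π) (i ≫ π)) = (pullback.lift f g
      (by simp only [← Category.assoc, h.w]) : W ⟶ pullback (i ≫ π) (j ≫ π)) ≫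
        (pullbackSymmetry (i ≫ π) (j ≫ π)).hom := by
      apply pullback.hom_ext <;> simp [pullback.lift_fst, pullback.lift_snd]
    have h' : IsClosedImmersion (pullback.lift g f (by simp only [← Category.assoc, h.w]) :
        W ⟶ pullback (j ≫ π) (i ≫ π)) := by
      rw [this]
      infer_instance
    exact h'
  · exact key h hcl
  · exact diag i

end TwoOpens

end AlgebraicGeometry

/-! ### Base change of the coordinate rings and of the transition maps -/

namespace CommRingCat

/-- Localization away from an element commutes with cobase change. -/
theorem isPushout_away {A A' B B' : Type u} [CommRing A] [CommRing A'] [CommRing B] [CommRing B']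
    [Algebra A B] [Algebra A' B'] (φ : A →+* A') (m : B →+* B') (x : A) (x' : A')
    [IsLocalization.Away x B] [IsLocalization.Away x' B'] (hx : φ x = x')
    (hm : m.comp (algebraMap A B) = (algebraMap A' B').comp φ) :
    IsPushout (ofHom (algebraMap A B)) (ofHom φ) (ofHom m) (ofHom (algebraMap A' B')) := by
  have key : ∀ s : PushoutCocone (ofHom (algebraMap A B)) (ofHom φ),
      ∃ l : of B' ⟶ s.pt, ofHom m ≫ l = s.inl ∧ ofHom (algebraMap A' B') ≫ l = s.inr := by
    intro s
    have hs : s.inl.hom.comp (algebraMap A B) = s.inr.hom.comp φ := congrArg Hom.hom s.condition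
    have hu : IsUnit (s.inr.hom x') := by
      have h2 : s.inr.hom x' = s.inl.hom (algebraMap A B x) := by
        rw [← hx]; exact (DFunLike.congr_fun hs x).symm
      rw [h2]
      exact (IsLocalization.Away.algebraMap_isUnit x).map s.inl.hom
    refine ⟨ofHom (IsLocalization.Away.lift x' hu), ?_, ?_⟩
    · ext1
      refine IsLocalization.ringHom_ext (Submonoid.powers x) ?_
      rw [hs]
      change ((IsLocalization.Away.lift x' hu).comp m).comp _ = _
      rw [RingHom.comp_assoc, hm, ← RingHom.comp_assoc, IsLocalization.Away.lift_comp]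
    · ext1
      exact IsLocalization.Away.lift_comp x' hu
  refine ⟨⟨?_⟩, ⟨PushoutCocone.IsColimit.mk _ (fun s ↦ (key s).choose)
    (fun s ↦ (key s).choose_spec.1) (fun s ↦ (key s).choose_spec.2) ?_⟩⟩
  · rw [← ofHom_comp, ← ofHom_comp, hm]
  · intro s l _ h2
    have h3 := h2.trans (key s).choose_spec.2.symm
    ext1
    exact IsLocalization.ringHom_ext (Submonoid.powers x') (congrArg Hom.hom h3)

end CommRingCat

namespace Hyperelliptic

section CoordRing

variable {R S : Type u} [CommRing R] [CommRing S]

/-- The map of coordinate rings induced by `φ : R → S` and an identification of `g'` with the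
image of `g`. -/
def mapHom (φ : R →+* S) (g : R[X]) (g' : S[X]) (hg' : g' = g.map φ) :
    CoordRing g →+* CoordRing g' :=
  evalHom g ((algebraMap S (CoordRing g')).comp φ) (coordX _) (coordY _) (by
    rw [coordY_sq, hg', Polynomial.eval₂_map])

variable (φ : R →+* S) (g : R[X]) (g' : S[X]) (hg' : g' = g.map φ)

@[simp] theorem mapHom_coordX : mapHom φ g g' hg' (coordX g) = coordX g' :=
  evalHom_coordX _ _ _ _ _

@[simp] theorem mapHom_coordY : mapHom φ g g' hg' (coordY g) = coordY g' :=
  evalHom_coordY _ _ _ _ _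

@[simp] theorem mapHom_algebraMap (r : R) : mapHom φ g g' hg' (algebraMap R (CoordRing g) r) =
    algebraMap S (CoordRing g') (φ r) :=
  evalHom_algebraMap _ _ _ _ _ _

/-- A homomorphism out of a coordinate ring is a homomorphism of the base together with a solution
of the equation, so both sides represent the same functor. -/
theorem isPushout_mapHom : IsPushout (CommRingCat.ofHom (algebraMap R (CoordRing g)))
    (CommRingCat.ofHom φ) (CommRingCat.ofHom (mapHom φ g g' hg'))
    (CommRingCat.ofHom (algebraMap S (CoordRing g'))) := by
  have key : ∀ s : PushoutCocone (CommRingCat.ofHom (algebraMap R (CoordRing g)))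
      (CommRingCat.ofHom φ), ∃ l : CommRingCat.of (CoordRing g') ⟶ s.pt,
      CommRingCat.ofHom (mapHom φ g g' hg') ≫ l = s.inl ∧
        CommRingCat.ofHom (algebraMap S (CoordRing g')) ≫ l = s.inr := by
    intro s
    have hs : s.inl.hom.comp (algebraMap R (CoordRing g)) = s.inr.hom.comp φ :=
      congrArg CommRingCat.Hom.hom s.condition
    have he : s.inl.hom (coordY g) ^ 2 = g'.eval₂ s.inr.hom (s.inl.hom (coordX g)) := by
      rw [hg', Polynomial.eval₂_map, ← hs, ← Polynomial.hom_eval₂, ← coordY_sq, map_pow]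
    refine ⟨CommRingCat.ofHom (evalHom g' s.inr.hom _ _ he), ?_, ?_⟩
    · ext1
      refine coordRing_hom_ext ?_ ?_ ?_
      · rw [hs]
        ext r
        simp
      · simp
      · simp
    · ext r
      simp
  refine ⟨⟨?_⟩, ⟨PushoutCocone.IsColimit.mk _ (fun s ↦ (key s).choose)
    (fun s ↦ (key s).choose_spec.1) (fun s ↦ (key s).choose_spec.2) ?_⟩⟩
  · ext r
    simp
  · intro s l h1 h2
    replace h1 := congrArg CommRingCat.Hom.hom (h1.trans (key s).choose_spec.1.symm)
    replace h2 := congrArg CommRingCat.Hom.hom (h2.trans (key s).choose_spec.2.symm)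
    ext1
    refine coordRing_hom_ext h2 ?_ ?_
    · simpa using DFunLike.congr_fun h1 (coordX g)
    · simpa using DFunLike.congr_fun h1 (coordY g)

/-- The map of overlap rings induced by `mapHom`. -/
def overlapMap : OverlapRing g →+* OverlapRing g' :=
  IsLocalization.Away.lift (coordX g)
    (g := (algebraMap (CoordRing g') (OverlapRing g')).comp (mapHom φ g g' hg')) (by
      simpa using IsLocalization.Away.algebraMap_isUnit (coordX g'))

theorem overlapMap_comp_algebraMap :
    (overlapMap φ g g' hg').comp (algebraMap (CoordRing g) (OverlapRing g)) =
      (algebraMap (CoordRing g') (OverlapRing g')).comp (mapHom φ g g' hg') :=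
  IsLocalization.Away.lift_comp _ _

theorem overlapMap_algebraMap (a : CoordRing g) :
    overlapMap φ g g' hg' (algebraMap (CoordRing g) (OverlapRing g) a) =
      algebraMap (CoordRing g') (OverlapRing g') (mapHom φ g g' hg' a) :=
  DFunLike.congr_fun (overlapMap_comp_algebraMap φ g g' hg') a

theorem overlapMap_invX : overlapMap φ g g' hg' (invX g) = invX g' := by
  have h1 := congrArg (overlapMap φ g g' hg') (coordX_mul_invX g)
  rw [map_mul, map_one, overlapMap_algebraMap, mapHom_coordX] at h1
  calc _ = (algebraMap (CoordRing g') (OverlapRing g') (coordX g') * invX g') *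
        overlapMap φ g g' hg' (invX g) := by rw [coordX_mul_invX, one_mul]
    _ = invX g' * (algebraMap (CoordRing g') (OverlapRing g') (coordX g') *
        overlapMap φ g g' hg' (invX g)) := by ring
    _ = _ := by rw [h1, mul_one]

theorem isPushout_overlapMap : IsPushout
    (CommRingCat.ofHom (algebraMap (CoordRing g) (OverlapRing g)))
    (CommRingCat.ofHom (mapHom φ g g' hg')) (CommRingCat.ofHom (overlapMap φ g g' hg'))
    (CommRingCat.ofHom (algebraMap (CoordRing g') (OverlapRing g'))) :=
  CommRingCat.isPushout_away _ _ (coordX g) (coordX g') (mapHom_coordX _ _ _ _)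
    (overlapMap_comp_algebraMap _ _ _ _)

/-- The exponents are kept separate because the genera of a polynomial and of its image are equal
only by hypothesis, not by definition. -/
theorem overlapMap_comp_transition (n n' : ℕ) (hn : n' = n) {h : R[X]} {h' : S[X]}
    (hg : g.natDegree ≤ 2 * n + 2) (hh : h = g.reflect (2 * n + 2))
    (hg'' : g'.natDegree ≤ 2 * n' + 2) (hh' : h' = g'.reflect (2 * n' + 2)) (hm : h' = h.map φ) :
    (overlapMap φ g g' hg').comp (transition g h n hg hh) =
      (transition g' h' n' hg'' hh').comp (mapHom φ h h' hm) := by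
  subst hn
  refine coordRing_hom_ext ?_ ?_ ?_
  · ext r
    have h1 : algebraMap R (OverlapRing g) r =
      algebraMap (CoordRing g) (OverlapRing g) (algebraMap R (CoordRing g) r) := rfl
    simp only [RingHom.comp_apply, transition, evalHom_algebraMap, mapHom_algebraMap]
    rw [h1, overlapMap_algebraMap, mapHom_algebraMap]
    rfl
  · simp [transition, overlapMap_invX]
  · simp [transition, overlapMap_invX, overlapMap_algebraMap]

end CoordRing

/-! ### The two charts of the complete curve -/

section Curve

variable {R : Type u} [CommRing R] (g : R[X])

/-- The inclusion of the chart at infinity. -/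
def infinityInclusion : affineChart (atInfinity g) ⟶ curve g :=
  pushout.inr (overlapToAffine g) (overlapToInfinity g)

instance : IsOpenImmersion (affineInclusion g) :=
  isOpenImmersion_pushout_inl

instance : IsOpenImmersion (infinityInclusion g) :=
  isOpenImmersion_pushout_inr

theorem isPullback_curve : IsPullback (overlapToAffine g) (overlapToInfinity g)
    (affineInclusion g) (infinityInclusion g) :=
  isPullback_pushout _ _

theorem isPushout_curve : IsPushout (overlapToAffine g) (overlapToInfinity g)
    (affineInclusion g) (infinityInclusion g) :=
  IsPushout.of_hasPushout _ _

theorem range_affineInclusion_union_range_infinityInclusion :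
    Set.range (affineInclusion g) ∪ Set.range (infinityInclusion g) = Set.univ :=
  range_pushout_inl_union_range_pushout_inr _ _

theorem infinityInclusion_curveStr : infinityInclusion g ≫ curveStr g =
    Spec.map (CommRingCat.ofHom (algebraMap R (CoordRing (atInfinity g)))) :=
  pushout.inr_desc _ _ _

theorem curve_hom_ext {T : Scheme.{u}} {a b : curve g ⟶ T}
    (h1 : affineInclusion g ≫ a = affineInclusion g ≫ b)
    (h2 : infinityInclusion g ≫ a = infinityInclusion g ≫ b) : a = b :=
  (isPushout_curve g).hom_ext h1 h2

end Curve

/-! ### Base change of the complete curve -/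

section BaseChange

variable {R S : Type u} [CommRing R] [CommRing S] (φ : R →+* S) (g : R[X])

/-- The chart is cartesian over the base by the pushout of coordinate rings; cancelling the defining
square of the base change leaves a square over the curve. -/
theorem isPullback_affineToBaseChange :
    IsPullback (Spec.map (CommRingCat.ofHom (mapHom φ g (g.map φ) rfl))) (affineToBaseChange φ g)
      (affineInclusion g) (pullback.fst (curveStr g) (Spec.map (CommRingCat.ofHom φ))) := by
  have h := isPullback_SpecMap_of_isPushout _ _ _ _ (isPushout_mapHom φ g (g.map φ) rfl)
  have h1 : affineToBaseChange φ g ≫ pullback.snd (curveStr g) (Spec.map (CommRingCat.ofHom φ)) =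
      Spec.map (CommRingCat.ofHom (algebraMap S (CoordRing (g.map φ)))) :=
    pullback.lift_snd _ _ _
  rw [← affineInclusion_curveStr g, ← h1] at h
  exact h.of_bot (pullback.lift_fst _ _ _).symm (IsPullback.of_hasPullback _ _)

variable (hgenus : genus (g.map φ) = genus g)

include hgenus in
-- The genus fixes the exponent used for reversal. It can drop when leading coefficients die under
-- `φ`, hence the hypothesis.
theorem atInfinity_map : atInfinity (g.map φ) = (atInfinity g).map φ := by
  rw [atInfinity, atInfinity, hgenus, reflect_map]

/-- The chart at infinity of the base change of a curve. -/
def infinityToBaseChange : affineChart (atInfinity (g.map φ)) ⟶ baseChange φ g :=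
  pullback.lift (Spec.map (CommRingCat.ofHom
      (mapHom φ (atInfinity g) _ (atInfinity_map φ g hgenus))) ≫ infinityInclusion g)
    (Spec.map (CommRingCat.ofHom (algebraMap S (CoordRing (atInfinity (g.map φ)))))) (by
      rw [Category.assoc, infinityInclusion_curveStr, ← Spec.map_comp, ← Spec.map_comp,
        ← CommRingCat.ofHom_comp, ← CommRingCat.ofHom_comp]
      congr 2
      ext r
      simp)

theorem isPullback_infinityToBaseChange :
    IsPullback (Spec.map (CommRingCat.ofHom
        (mapHom φ (atInfinity g) _ (atInfinity_map φ g hgenus)))) (infinityToBaseChange φ g hgenus)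
      (infinityInclusion g) (pullback.fst (curveStr g) (Spec.map (CommRingCat.ofHom φ))) := by
  have h := isPullback_SpecMap_of_isPushout _ _ _ _
    (isPushout_mapHom φ (atInfinity g) _ (atInfinity_map φ g hgenus))
  have h1 : infinityToBaseChange φ g hgenus ≫
      pullback.snd (curveStr g) (Spec.map (CommRingCat.ofHom φ)) =
      Spec.map (CommRingCat.ofHom (algebraMap S (CoordRing (atInfinity (g.map φ))))) :=
    pullback.lift_snd _ _ _
  rw [← infinityInclusion_curveStr g, ← h1] at h
  exact h.of_bot (pullback.lift_fst _ _ _).symm (IsPullback.of_hasPullback _ _)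

instance : IsOpenImmersion (affineToBaseChange φ g) :=
  MorphismProperty.of_isPullback (P := @IsOpenImmersion) (isPullback_affineToBaseChange φ g)
    inferInstance

instance : IsOpenImmersion (infinityToBaseChange φ g hgenus) :=
  MorphismProperty.of_isPullback (P := @IsOpenImmersion)
    (isPullback_infinityToBaseChange φ g hgenus) inferInstance

theorem range_affineToBaseChange_union :
    Set.range (affineToBaseChange φ g) ∪ Set.range (infinityToBaseChange φ g hgenus) =
      Set.univ := by
  rw [Set.eq_univ_iff_forall]
  intro x
  rcases (range_affineInclusion_union_range_infinityInclusion g).symm ▸ Set.mem_univ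
    (pullback.fst (curveStr g) (Spec.map (CommRingCat.ofHom φ)) x) with ⟨y, hy⟩ | ⟨y, hy⟩
  · obtain ⟨z, -, hz⟩ :=
      Scheme.exists_preimage_of_isPullback (isPullback_affineToBaseChange φ g) y x hy
    exact Or.inl ⟨z, hz⟩
  · obtain ⟨z, -, hz⟩ :=
      Scheme.exists_preimage_of_isPullback (isPullback_infinityToBaseChange φ g hgenus) y x hy
    exact Or.inr ⟨z, hz⟩

theorem isPullback_overlapToAffine :
    IsPullback (overlapToAffine (g.map φ))
      (Spec.map (CommRingCat.ofHom (overlapMap φ g (g.map φ) rfl)))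
      (Spec.map (CommRingCat.ofHom (mapHom φ g (g.map φ) rfl))) (overlapToAffine g) :=
  (isPullback_SpecMap_of_isPushout _ _ _ _ (isPushout_overlapMap φ g (g.map φ) rfl)).flip

include hgenus in
theorem overlapToInfinity_mapHom : overlapToInfinity (g.map φ) ≫ Spec.map (CommRingCat.ofHom
      (mapHom φ (atInfinity g) _ (atInfinity_map φ g hgenus))) =
      Spec.map (CommRingCat.ofHom (overlapMap φ g (g.map φ) rfl)) ≫ overlapToInfinity g := by
  rw [← Spec.map_comp, ← Spec.map_comp, ← CommRingCat.ofHom_comp, ← CommRingCat.ofHom_comp]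
  congr 2
  exact (overlapMap_comp_transition φ g _ rfl _ _ hgenus _ _ _ _ _).symm

theorem overlapToAffine_affineToBaseChange :
    overlapToAffine (g.map φ) ≫ affineToBaseChange φ g =
      overlapToInfinity (g.map φ) ≫ infinityToBaseChange φ g hgenus := by
  apply pullback.hom_ext
  · rw [Category.assoc, Category.assoc, ← (isPullback_affineToBaseChange φ g).w,
      ← (isPullback_infinityToBaseChange φ g hgenus).w, (isPullback_overlapToAffine φ g).w_assoc,
      ← Category.assoc (overlapToInfinity _), overlapToInfinity_mapHom φ g hgenus, Category.assoc,
      (isPullback_curve g).w]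
  · rw [Category.assoc, Category.assoc, affineToBaseChange, infinityToBaseChange,
      pullback.lift_snd, pullback.lift_snd, ← affineInclusion_curveStr,
      ← infinityInclusion_curveStr, (isPullback_curve (g.map φ)).w_assoc]

theorem isPullback_baseChange : IsPullback (overlapToAffine (g.map φ))
    (overlapToInfinity (g.map φ)) (affineToBaseChange φ g) (infinityToBaseChange φ g hgenus) :=
  isPullback_of_baseChange (isPullback_curve g)
    (isPullback_overlapToAffine φ g)
    (isPullback_affineToBaseChange φ g).flip (isPullback_infinityToBaseChange φ g hgenus).flip
    (overlapToInfinity_mapHom φ g hgenus)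
    (overlapToAffine_affineToBaseChange φ g hgenus)

theorem isPushout_baseChange : IsPushout (overlapToAffine (g.map φ))
    (overlapToInfinity (g.map φ)) (affineToBaseChange φ g) (infinityToBaseChange φ g hgenus) :=
  isPushout_of_isPullback (isPullback_baseChange φ g hgenus)
    (range_affineToBaseChange_union φ g hgenus)

/-- The formation of the complete curve commutes with base change. -/
def curveIsoBaseChange : curve (g.map φ) ≅ baseChange φ g :=
  (isPushout_curve (g.map φ)).isoIsPushout _ _ (isPushout_baseChange φ g hgenus)

theorem affineInclusion_curveIsoBaseChange_hom :
    affineInclusion (g.map φ) ≫ (curveIsoBaseChange φ g hgenus).hom = affineToBaseChange φ g :=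
  IsPushout.inl_isoIsPushout_hom _ _ _ _

theorem infinityInclusion_curveIsoBaseChange_hom :
    infinityInclusion (g.map φ) ≫ (curveIsoBaseChange φ g hgenus).hom =
      infinityToBaseChange φ g hgenus :=
  IsPushout.inr_isoIsPushout_hom _ _ _ _

theorem affineToBaseChange_curveIsoBaseChange_inv :
    affineToBaseChange φ g ≫ (curveIsoBaseChange φ g hgenus).inv = affineInclusion (g.map φ) := by
  rw [Iso.comp_inv_eq, affineInclusion_curveIsoBaseChange_hom]

theorem curveIsoBaseChange_hom_str : (curveIsoBaseChange φ g hgenus).hom ≫ baseChangeStr φ g =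
    curveStr (g.map φ) := by
  apply curve_hom_ext
  · rw [reassoc_of% affineInclusion_curveIsoBaseChange_hom φ g hgenus, affineInclusion_curveStr]
    exact pullback.lift_snd _ _ _
  · rw [reassoc_of% infinityInclusion_curveIsoBaseChange_hom φ g hgenus, infinityInclusion_curveStr]
    exact pullback.lift_snd _ _ _

end BaseChange

end Hyperelliptic

/-! ### Flatness and properness of the complete curve -/

namespace Hyperelliptic

section Proper

variable {R : Type u} [CommRing R] (g : R[X])

/-- Both charts are spectra of coordinate rings of the same form, so a property local on the source
needs checking only for these. -/
theorem hasRingHomProperty_curveStr (P : MorphismProperty Scheme.{u})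
    {Q : ∀ {A B : Type u} [CommRing A] [CommRing B], (A →+* B) → Prop} [HasRingHomProperty P Q]
    (h : ∀ h : R[X], Q (algebraMap R (CoordRing h))) :
    P (curveStr g) := by
  rw [IsZariskiLocalAtSource.iff_of_openCover (P := P) (twoOpenCover _ _
    (range_affineInclusion_union_range_infinityInclusion g))]
  intro b
  cases b
  · change P (infinityInclusion g ≫ curveStr g)
    rw [infinityInclusion_curveStr]
    exact (HasRingHomProperty.Spec_iff (P := P)).2 (h _)
  · change P (affineInclusion g ≫ curveStr g)
    rw [affineInclusion_curveStr]
    exact (HasRingHomProperty.Spec_iff (P := P)).2 (h _)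

instance : Module.Flat R (CoordRing g) := by
  have h : (X ^ 2 - C g : R[X][X]).Monic := monic_X_pow_sub_C g two_ne_zero
  have : Module.Free R[X] (CoordRing g) := h.free_adjoinRoot
  exact Module.Flat.trans R R[X] (CoordRing g)

instance : Algebra.FiniteType R (CoordRing g) := by
  have : Algebra.FiniteType R[X] (CoordRing g) := inferInstance
  exact Algebra.FiniteType.trans (S := R[X]) inferInstance inferInstance

instance flat_curveStr : Flat (curveStr g) := by
  refine hasRingHomProperty_curveStr g @Flat fun h ↦ ?_
  exact (RingHom.flat_algebraMap_iff).2 inferInstance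

instance locallyOfFiniteType_curveStr : LocallyOfFiniteType (curveStr g) := by
  refine hasRingHomProperty_curveStr g @LocallyOfFiniteType fun h ↦ ?_
  exact (RingHom.finiteType_algebraMap).2 inferInstance

instance : CompactSpace (curve g) := by
  rw [← isCompact_univ_iff, ← range_affineInclusion_union_range_infinityInclusion]
  exact (isCompact_range (affineInclusion g).continuous).union
    (isCompact_range (infinityInclusion g).continuous)

instance quasiCompact_curveStr : QuasiCompact (curveStr g) := inferInstance

/-- The restriction map from the coordinate ring of the chart at infinity to that of the overlap. -/
def infinityTransition : CoordRing (atInfinity g) →+* OverlapRing g :=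
  transition g (atInfinity g) (genus g) (natDegree_le_genus g) rfl

theorem overlapToInfinity_eq :
    overlapToInfinity g = Spec.map (CommRingCat.ofHom (infinityTransition g)) :=
  rfl

theorem infinityTransition_coordX : infinityTransition g (coordX _) = invX g :=
  evalHom_coordX _ _ _ _ (transition_eq g (genus g) (natDegree_le_genus g))

theorem infinityTransition_coordY : infinityTransition g (coordY _) =
    algebraMap (CoordRing g) (OverlapRing g) (coordY g) * invX g ^ (genus g + 1) :=
  evalHom_coordY _ _ _ _ (transition_eq g (genus g) (natDegree_le_genus g))

theorem infinityTransition_algebraMap (r : R) :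
    infinityTransition g (algebraMap R _ r) = algebraMap R (OverlapRing g) r :=
  evalHom_algebraMap _ _ _ _ (transition_eq g (genus g) (natDegree_le_genus g)) _

/-- Through `transitionEquiv` the overlap is also the localization of the chart at infinity at u. -/
theorem exists_comp_infinityTransition {T : Type u} [CommRing T]
    (ψ : CoordRing (atInfinity g) →+* T) (hψ : IsUnit (ψ (coordX _))) :
    ∃ l : OverlapRing g →+* T, l.comp (infinityTransition g) = ψ := by
  let e := transitionEquiv g (atInfinity g) (genus g) (natDegree_le_genus g) rfl
  let m : OverlapRing (atInfinity g) →+* T :=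
    IsLocalization.Away.lift (S := OverlapRing (atInfinity g)) (coordX _) (g := ψ) hψ
  have he : ∀ a, e.symm (infinityTransition g a) = algebraMap _ _ a := by
    intro a
    rw [RingEquiv.symm_apply_eq]
    exact (transitionLift_algebraMap _ _ _ _ _ _).symm
  refine ⟨m.comp (e.symm : OverlapRing g →+* OverlapRing (atInfinity g)), ?_⟩
  refine RingHom.ext fun a ↦ ?_
  simp only [RingHom.comp_apply]
  refine (congrArg m (he a)).trans ?_
  exact IsLocalization.Away.lift_eq _ _ _

/-- An element a/xⁿ of the overlap is a · uⁿ. This makes the overlap closed in the product of the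
two charts, which is what separatedness needs. -/
theorem exists_mul_infinityTransition (z : OverlapRing g) : ∃ (a : CoordRing g)
    (b : CoordRing (atInfinity g)), algebraMap (CoordRing g) (OverlapRing g) a *
      infinityTransition g b = z := by
  obtain ⟨n, a, h⟩ := IsLocalization.Away.surj (coordX g) z
  refine ⟨a, coordX _ ^ n, ?_⟩
  rw [map_pow, infinityTransition_coordX, ← h, mul_assoc, ← mul_pow, coordX_mul_invX, one_pow,
    mul_one]

/-- The map corresponds to A ⊗ B → C, and by hypothesis pure tensors already hit every element. -/
theorem isClosedImmersion_lift_specMap {A B C : Type u} [CommRing A] [CommRing B] [CommRing C]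
    [Algebra R A] [Algebra R B] [Algebra R C] (a : A →ₐ[R] C) (b : B →ₐ[R] C)
    (h : ∀ c, ∃ x y, a x * b y = c) {α : Spec (CommRingCat.of A) ⟶ Spec (CommRingCat.of R)}
    {β : Spec (CommRingCat.of B) ⟶ Spec (CommRingCat.of R)}
    (hα : α = Spec.map (CommRingCat.ofHom (algebraMap R A)))
    (hβ : β = Spec.map (CommRingCat.ofHom (algebraMap R B))) (hw) : IsClosedImmersion
      (pullback.lift (Spec.map (CommRingCat.ofHom a.toRingHom))
        (Spec.map (CommRingCat.ofHom b.toRingHom)) hw :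
        Spec (CommRingCat.of C) ⟶ pullback α β) := by
  subst hα hβ
  have h1 : (pullback.lift (Spec.map (CommRingCat.ofHom a.toRingHom))
        (Spec.map (CommRingCat.ofHom b.toRingHom)) hw :
        Spec (CommRingCat.of C) ⟶ pullback (Spec.map (CommRingCat.ofHom (algebraMap R A)))
          (Spec.map (CommRingCat.ofHom (algebraMap R B)))) =
      Spec.map (CommRingCat.ofHom (Algebra.TensorProduct.lift a b fun _ _ ↦ .all _ _).toRingHom) ≫
        (pullbackSpecIso R A B).inv := by
    apply pullback.hom_ext
    · rw [pullback.lift_fst, Category.assoc, pullbackSpecIso_inv_fst, ← Spec.map_comp,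
        ← CommRingCat.ofHom_comp]
      congr 2
      ext x
      simp
    · rw [pullback.lift_snd, Category.assoc, pullbackSpecIso_inv_snd, ← Spec.map_comp,
        ← CommRingCat.ofHom_comp]
      congr 2
      ext x
      simp
  rw [h1]
  have := IsClosedImmersion.spec_of_surjective (CommRingCat.ofHom
    (Algebra.TensorProduct.lift a b fun _ _ ↦ .all _ _).toRingHom) (fun c ↦ by
      obtain ⟨x, y, rfl⟩ := h c
      exact ⟨x ⊗ₜ y, by simp⟩)
  infer_instance

instance isSeparated_curveStr : IsSeparated (curveStr g) := by
  have : IsSeparated (affineInclusion g ≫ curveStr g) := by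
    rw [affineInclusion_curveStr]
    infer_instance
  have : IsSeparated (infinityInclusion g ≫ curveStr g) := by
    rw [infinityInclusion_curveStr]
    infer_instance
  refine isSeparated_of_isClosedImmersion_lift (isPullback_curve g)
    (range_affineInclusion_union_range_infinityInclusion g) _ ?_
  let b : CoordRing (atInfinity g) →ₐ[R] OverlapRing g :=
    { infinityTransition g with
      commutes' := infinityTransition_algebraMap g }
  exact isClosedImmersion_lift_specMap (IsScalarTower.toAlgHom R (CoordRing g)
    (OverlapRing g)) b (exists_mul_infinityTransition g) (affineInclusion_curveStr g)
    (infinityInclusion_curveStr g) _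

/-- A point of the affine chart over the field of fractions of a valuation ring (or any other
integrally closed domain) extends to an integral point when its `x`-coordinate is integral. -/
theorem exists_lift_coordRing {O K : Type u} [CommRing O] [IsDomain O] [IsIntegrallyClosed O]
    [Field K] [Algebra O K] [IsFractionRing O K] (φ : CoordRing g →+* K) (r : R →+* O)
    (hr : (algebraMap O K).comp r = φ.comp (algebraMap R (CoordRing g)))
    (hx : φ (coordX g) ∈ Set.range (algebraMap O K)) :
    ∃ φ' : CoordRing g →+* O, (algebraMap O K).comp φ' = φ ∧
      φ'.comp (algebraMap R (CoordRing g)) = r := by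
  obtain ⟨a, ha⟩ := hx
  have h1 : φ (coordY g) ^ 2 = algebraMap O K (g.eval₂ r a) := by
    rw [← map_pow, coordY_sq, hom_eval₂, hom_eval₂, ← hr, ha]
  -- With x integral, y² = g(x) is integral, hence so is y.
  have h2 : IsIntegral O (φ (coordY g)) := by
    refine IsIntegral.of_pow two_pos ?_
    rw [h1]
    exact isIntegral_algebraMap
  obtain ⟨b, hb⟩ := IsIntegrallyClosed.isIntegral_iff.1 h2
  refine ⟨evalHom g r a b ?_, coordRing_hom_ext ?_ ?_ ?_, ?_⟩
  · apply IsFractionRing.injective O K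
    rw [← h1, map_pow, hb]
  · rw [← hr]
    ext
    simp
  · simpa using ha
  · simpa using hb
  · ext
    simp

/-- A field-valued point of the affine chart with `x ≠ 0` is a point of the chart at infinity. -/
theorem exists_infinity_point {K : Type u} [Field K] (φ : CoordRing g →+* K)
    (hx : φ (coordX g) ≠ 0) : ∃ ψ : CoordRing (atInfinity g) →+* K,
      Spec.map (CommRingCat.ofHom ψ) ≫ infinityInclusion g =
        Spec.map (CommRingCat.ofHom φ) ≫ affineInclusion g ∧
      ψ (coordX _) = (φ (coordX g))⁻¹ := by
  let l : OverlapRing g →+* K := IsLocalization.Away.lift (coordX g) (g := φ) hx.isUnit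
  have hl : l.comp (algebraMap (CoordRing g) (OverlapRing g)) = φ :=
    IsLocalization.Away.lift_comp _ _
  refine ⟨l.comp (infinityTransition g), ?_, ?_⟩
  · rw [CommRingCat.ofHom_comp, Spec.map_comp, Category.assoc, ← overlapToInfinity_eq,
      ← (isPullback_curve g).w, ← Category.assoc, ← Spec.map_comp, ← CommRingCat.ofHom_comp, hl]
  · rw [RingHom.comp_apply, infinityTransition_coordX]
    refine eq_inv_of_mul_eq_one_right ?_
    rw [← hl, RingHom.comp_apply, ← map_mul, coordX_mul_invX, map_one]

/-- A field-valued point of the chart at infinity with `u ≠ 0` is a point of the affine chart. -/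
theorem exists_affine_point {K : Type u} [Field K] (ψ : CoordRing (atInfinity g) →+* K)
    (hx : ψ (coordX _) ≠ 0) : ∃ φ : CoordRing g →+* K,
      Spec.map (CommRingCat.ofHom φ) ≫ affineInclusion g =
        Spec.map (CommRingCat.ofHom ψ) ≫ infinityInclusion g ∧
      φ (coordX g) = (ψ (coordX _))⁻¹ := by
  obtain ⟨l, hl⟩ := exists_comp_infinityTransition g ψ hx.isUnit
  refine ⟨l.comp (algebraMap _ _), ?_, ?_⟩
  · rw [CommRingCat.ofHom_comp, Spec.map_comp, Category.assoc, (isPullback_curve g).w,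
      overlapToInfinity_eq, ← Category.assoc, ← Spec.map_comp, ← CommRingCat.ofHom_comp, hl]
  · rw [RingHom.comp_apply]
    refine eq_inv_of_mul_eq_one_left ?_
    rw [← hl, RingHom.comp_apply, ← map_mul, infinityTransition_coordX, coordX_mul_invX, map_one]

/-- The spectrum of a field has one point, so a field-valued point meeting an open subscheme factors
through it. -/
theorem exists_specMap_of_range_subset {Y : Scheme.{u}} {A K : Type u} [CommRing A] [Field K]
    (i : Spec (CommRingCat.of A) ⟶ Y) [IsOpenImmersion i] (q : Spec (CommRingCat.of K) ⟶ Y)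
    (x : Spec (CommRingCat.of K)) (hx : q x ∈ Set.range i) :
    ∃ φ : A →+* K, Spec.map (CommRingCat.ofHom φ) ≫ i = q := by
  have : Subsingleton (Spec (CommRingCat.of K)) :=
    inferInstanceAs (Subsingleton (PrimeSpectrum K))
  have hq : Set.range q ⊆ Set.range i := by
    rintro _ ⟨y, rfl⟩
    rwa [Subsingleton.elim y x]
  obtain ⟨φ, hφ⟩ := Spec.map_surjective (IsOpenImmersion.lift i q hq)
  refine ⟨φ.hom, ?_⟩
  rw [← IsOpenImmersion.lift_fac i q hq, ← hφ]
  rfl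

/-- A K-point lies in one of the charts. If its x- or u-coordinate there is not in the valuation
ring, the inverse is, and that inverse is the coordinate in the other chart. -/
theorem existence_curveStr : ValuativeCriterion.Existence (curveStr g) := by
  rintro ⟨O, K, q, s, ⟨hw⟩⟩
  obtain ⟨r, rfl⟩ := Spec.map_surjective s
  have lift : ∀ (h : R[X]) (i : affineChart h ⟶ curve g) (hi : i ≫ curveStr g =
      Spec.map (CommRingCat.ofHom (algebraMap R (CoordRing h)))) (φ : CoordRing h →+* K)
      (hφ : Spec.map (CommRingCat.ofHom φ) ≫ i = q)
      (hx : φ (coordX h) ∈ Set.range (algebraMap O K)), ∃ l : Spec (CommRingCat.of O) ⟶ curve g,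
        Spec.map (CommRingCat.ofHom (algebraMap O K)) ≫ l = q ∧ l ≫ curveStr g = Spec.map r := by
    intro h i hi φ hφ hx
    have hr : (algebraMap O K).comp r.hom = φ.comp (algebraMap R (CoordRing h)) := by
      rw [← hφ, Category.assoc, hi, ← Spec.map_comp, ← Spec.map_comp] at hw
      exact congrArg CommRingCat.Hom.hom (Spec.map_injective hw).symm
    obtain ⟨φ', h1, h2⟩ := exists_lift_coordRing h φ r.hom hr hx
    refine ⟨Spec.map (CommRingCat.ofHom φ') ≫ i, ?_, ?_⟩
    · rw [← hφ, ← h1, CommRingCat.ofHom_comp, Spec.map_comp, Category.assoc]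
    · rw [Category.assoc, hi, ← Spec.map_comp, ← CommRingCat.ofHom_comp, h2]
      rfl
  suffices h : ∃ l : Spec (CommRingCat.of O) ⟶ curve g,
      Spec.map (CommRingCat.ofHom (algebraMap O K)) ≫ l = q ∧ l ≫ curveStr g = Spec.map r by
    obtain ⟨l, h1, h2⟩ := h
    exact ⟨⟨⟨l, h1, h2⟩⟩⟩
  let x : Spec (CommRingCat.of K) := (⊥ : PrimeSpectrum K)
  rcases (range_affineInclusion_union_range_infinityInclusion g).symm ▸ Set.mem_univ (q x)
    with hx | hx
  · obtain ⟨φ, hφ⟩ := exists_specMap_of_range_subset (affineInclusion g) q x hx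
    by_cases hm : φ (coordX g) ∈ Set.range (algebraMap O K)
    · exact lift g _ (affineInclusion_curveStr g) φ hφ hm
    · have h0 : φ (coordX g) ≠ 0 := fun h ↦ hm ⟨0, by rw [h, map_zero]⟩
      obtain ⟨ψ, h1, h2⟩ := exists_infinity_point g φ h0
      refine lift _ _ (infinityInclusion_curveStr g) ψ (h1.trans hφ) ?_
      rw [h2]
      exact (ValuationRing.isInteger_or_isInteger O (φ (coordX g))).resolve_left hm
  · obtain ⟨ψ, hψ⟩ := exists_specMap_of_range_subset (infinityInclusion g) q x hx
    by_cases hm : ψ (coordX _) ∈ Set.range (algebraMap O K)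
    · exact lift _ _ (infinityInclusion_curveStr g) ψ hψ hm
    · have h0 : ψ (coordX _) ≠ 0 := fun h ↦ hm ⟨0, by rw [h, map_zero]⟩
      obtain ⟨φ, h1, h2⟩ := exists_affine_point g ψ h0
      refine lift _ _ (affineInclusion_curveStr g) φ (h1.trans hψ) ?_
      rw [h2]
      exact (ValuationRing.isInteger_or_isInteger O (ψ (coordX _))).resolve_left hm

instance isProper_curveStr : IsProper (curveStr g) where
  __ := isSeparated_curveStr g
  __ := locallyOfFiniteType_curveStr g
  __ := UniversallyClosed.of_valuativeCriterion _ (existence_curveStr g)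

end Proper

end Hyperelliptic

/-! ### Reversed polynomials under a linear substitution -/

namespace Polynomial

variable {R T : Type*} [CommRing R] [CommRing T]

theorem reflect_eq_sum (N : ℕ) (f : R[X]) (hf : f.natDegree ≤ N) :
    f.reflect N = ∑ k ∈ Finset.range (N + 1), C (f.coeff k) * X ^ (N - k) := by
  have hs : ∀ s : Finset ℕ, reflect N (∑ k ∈ s, C (f.coeff k) * X ^ k) =
      ∑ k ∈ s, reflect N (C (f.coeff k) * X ^ k) := by
    intro s
    classical
    induction s using Finset.induction_on with
    | empty => simp
    | insert a s ha ih => rw [Finset.sum_insert ha, Finset.sum_insert ha, reflect_add, ih]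
  conv_lhs => rw [f.as_sum_range_C_mul_X_pow' (Nat.lt_succ_of_le hf), hs]
  refine Finset.sum_congr rfl fun k hk ↦ ?_
  rw [reflect_C_mul_X_pow, revAt_le (Nat.lt_succ_iff.1 (Finset.mem_range.1 hk))]

theorem natDegree_linear_pow_le (a b : R) (k : ℕ) : ((C a * X + C b) ^ k).natDegree ≤ k :=
  natDegree_pow_le.trans ((Nat.mul_le_mul_left k natDegree_linear_le).trans (mul_one k).le)

theorem reflect_linear_pow (a b : R) (k N : ℕ) (hk : k ≤ N) :
    ((C a * X + C b) ^ k).reflect N = (C a + C b * X) ^ k * X ^ (N - k) := by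
  have h1 : (C a * X + C b).reflect 1 = C a + C b * X := by
    rw [reflect_add, reflect_C_mul, reflect_one_X, reflect_C, mul_one, pow_one]
  have h2 : ∀ k : ℕ, ((C a * X + C b) ^ k).reflect k = (C a + C b * X) ^ k := by
    intro k
    induction k with
    | zero => simp
    | succ k ih =>
      rw [pow_succ, pow_succ, reflect_mul _ _ (natDegree_linear_pow_le a b k) natDegree_linear_le,
        ih, h1]
  obtain ⟨m, rfl⟩ := Nat.exists_eq_add_of_le hk
  have h3 := reflect_mul ((C a * X + C b) ^ k) 1 (natDegree_linear_pow_le a b k)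
    (G := m) (by simp)
  rw [mul_one, h2, reflect_one] at h3
  rw [h3, Nat.add_sub_cancel_left]

theorem reflect_comp_linear (a b : R) (N : ℕ) (f : R[X]) (hf : f.natDegree ≤ N) :
    (f.comp (C a * X + C b)).reflect N =
      ∑ k ∈ Finset.range (N + 1), C (f.coeff k) * ((C a + C b * X) ^ k * X ^ (N - k)) := by
  have hs : ∀ s : Finset ℕ, reflect N (∑ k ∈ s, C (f.coeff k) * (C a * X + C b) ^ k) =
      ∑ k ∈ s, reflect N (C (f.coeff k) * (C a * X + C b) ^ k) := by
    intro s
    classical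
    induction s using Finset.induction_on with
    | empty => simp
    | insert a s ha ih => rw [Finset.sum_insert ha, Finset.sum_insert ha, reflect_add, ih]
  rw [comp, eval₂_eq_sum_range' _ (Nat.lt_succ_of_le hf), hs]
  refine Finset.sum_congr rfl fun k hk ↦ ?_
  rw [reflect_C_mul, reflect_linear_pow a b k N (Nat.lt_succ_iff.1 (Finset.mem_range.1 hk))]

/-- The behaviour of the reversed polynomial under the substitution `x ↦ a x + b`, that is,
`u ↦ u / (a + b u)` for `u = 1 / x`. -/
theorem eval₂_reflect_comp_linear (i : R →+* T) (a b : R) (N : ℕ) (f : R[X]) (hf : f.natDegree ≤ N)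
    (u r : T) (hr : (i a + i b * u) * r = 1) :
    (f.reflect N).eval₂ i (u * r) =
      r ^ N * ((f.comp (C a * X + C b)).reflect N).eval₂ i u := by
  rw [reflect_comp_linear a b N f hf, reflect_eq_sum N f hf, eval₂_finsetSum, eval₂_finsetSum,
    Finset.mul_sum]
  refine Finset.sum_congr rfl fun k hk ↦ ?_
  have hk' : k ≤ N := Nat.lt_succ_iff.1 (Finset.mem_range.1 hk)
  simp only [eval₂_mul, eval₂_C, eval₂_pow, eval₂_X, eval₂_add]
  obtain ⟨m, rfl⟩ := Nat.exists_eq_add_of_le hk'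
  rw [Nat.add_sub_cancel_left]
  calc _ = i (f.coeff k) * (((i a + i b * u) * r) ^ k * (u * r) ^ m) := by rw [hr]; ring
    _ = _ := by rw [mul_pow (i a + i b * u), mul_pow u]; ring

end Polynomial

/-! ### Morphisms agreeing on a dense subscheme -/

namespace AlgebraicGeometry

/-- Two morphisms from an affine scheme to a separated scheme agree if they agree on a
scheme-theoretically dense affine subscheme. -/
theorem specMap_comp_injective {B C : Type u} [CommRing B] [CommRing C] {Y S : Scheme.{u}}
    (φ : B →+* C) (hφ : Function.Injective φ) (s : Y ⟶ S) [IsSeparated s]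
    {a b : Spec (CommRingCat.of B) ⟶ Y} (hs : a ≫ s = b ≫ s)
    (h : Spec.map (CommRingCat.ofHom φ) ≫ a = Spec.map (CommRingCat.ofHom φ) ≫ b) : a = b := by
  -- This is the equalizer of `a` and `b`, closed in Spec B by separatedness. Spec C factors through
  -- it, so the injectivity of `φ` forces it to be all of Spec B.
  let ι := pullback.fst (pullback.lift a b hs) (pullback.diagonal s)
  let l : Spec (CommRingCat.of C) ⟶ pullback (pullback.lift a b hs) (pullback.diagonal s) :=
    pullback.lift (Spec.map (CommRingCat.ofHom φ)) (Spec.map (CommRingCat.ofHom φ) ≫ a) (by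
      apply pullback.hom_ext
      · simp [pullback.lift_fst]
      · simp [pullback.lift_snd, h])
  have hl : l ≫ ι = Spec.map (CommRingCat.ofHom φ) := pullback.lift_fst _ _ _
  have hinj : Function.Injective ι.appTop := by
    have h2 : Function.Injective (Spec.map (CommRingCat.ofHom φ)).appTop := by
      have h3 := Scheme.ΓSpecIso_naturality (CommRingCat.ofHom φ)
      have h4 : Function.Injective ((Spec.map (CommRingCat.ofHom φ)).appTop ≫
          (Scheme.ΓSpecIso (CommRingCat.of C)).hom) := by
        rw [h3]
        exact hφ.comp (ConcreteCategory.bijective_of_isIso _).1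
      exact Function.Injective.of_comp h4
    rw [← hl, Scheme.Hom.comp_appTop] at h2
    exact Function.Injective.of_comp h2
  have : IsIso ι := IsClosedImmersion.isIso_of_injective_of_isAffine hinj
  have h3 : ι ≫ a = ι ≫ b := by
    have h4 := pullback.condition (f := pullback.lift a b hs) (g := pullback.diagonal s)
    have h5 := h4 =≫ pullback.fst _ _
    have h6 := h4 =≫ pullback.snd _ _
    simp only [Category.assoc, pullback.lift_fst, pullback.lift_snd, pullback.diagonal_fst,
      pullback.diagonal_snd] at h5 h6
    exact h5.trans h6.symm
  exact (cancel_epi ι).1 h3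

end AlgebraicGeometry

namespace Hyperelliptic

/-! ### Density of the overlap, and shrinking the chart at infinity -/

section Substitution

variable {R : Type u} [CommRing R]

/-- The coordinate ring is free over R[x], and a regular element stays regular in a flat algebra. No
assumption on R is needed. -/
theorem coordX_mem_nonZeroDivisors (g : R[X]) : coordX g ∈ nonZeroDivisors (CoordRing g) := by
  have h : (X ^ 2 - C g : R[X][X]).Monic := monic_X_pow_sub_C g two_ne_zero
  have : Module.Free R[X] (CoordRing g) := h.free_adjoinRoot
  have h1 : (X : R[X]) ∈ nonZeroDivisors R[X] := Monic.mem_nonZeroDivisors monic_X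
  have h2 : IsSMulRegular R[X] (X : R[X]) := fun y z hyz ↦ (mul_cancel_left_mem_nonZeroDivisors h1).1 hyz
  have h3 : IsSMulRegular (CoordRing g) (coordX g) := h2.of_flat
  rw [mem_nonZeroDivisors_iff_left]
  intro z hz
  exact h3 (hz.trans (mul_zero _).symm)

/-- Inverting the regular element u loses nothing: the overlap is scheme-theoretically dense in the
chart at infinity. -/
theorem infinityTransition_injective (g : R[X]) : Function.Injective (infinityTransition g) := by
  let e := transitionEquiv g (atInfinity g) (genus g) (natDegree_le_genus g) rfl
  have he : ∀ a, e (algebraMap _ _ a) = infinityTransition g a :=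
    fun a ↦ transitionLift_algebraMap _ _ _ _ _ _
  intro a b hab
  rw [← he, ← he] at hab
  exact IsLocalization.injective (M := Submonoid.powers (coordX (atInfinity g)))
    (OverlapRing (atInfinity g)) (Submonoid.powers_le.2 (coordX_mem_nonZeroDivisors _))
    (e.injective hab)

/-- Morphisms from a complete curve to a separated scheme agree if they agree on the affine
chart. -/
theorem curve_hom_ext_of_isSeparated (g : R[X]) {Y S : Scheme.{u}} (s : Y ⟶ S) [IsSeparated s]
    {a b : curve g ⟶ Y} (hs : a ≫ s = b ≫ s) (h : affineInclusion g ≫ a = affineInclusion g ≫ b) :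
    a = b := by
  refine curve_hom_ext g h (specMap_comp_injective (infinityTransition g)
    (infinityTransition_injective g) s (by simp [hs]) ?_)
  have h1 := (isPullback_curve g).w
  rw [overlapToInfinity_eq] at h1
  rw [← reassoc_of% h1, ← reassoc_of% h1, h]

theorem mem_range_overlapToInfinity (g : R[X]) (P : affineChart (atInfinity g))
    (hP : coordX (atInfinity g) ∉ P.asIdeal) : P ∈ Set.range (overlapToInfinity g) := by
  let e := transitionEquiv g (atInfinity g) (genus g) (natDegree_le_genus g) rfl
  have he : (e : OverlapRing (atInfinity g) →+* OverlapRing g).comp (algebraMap _ _) =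
      infinityTransition g :=
    RingHom.ext fun a ↦ transitionLift_algebraMap _ _ _ _ _ _
  have h1 : (P : PrimeSpectrum (CoordRing (atInfinity g))) ∈
      Set.range (PrimeSpectrum.comap (algebraMap _ (OverlapRing (atInfinity g)))) := by
    rw [PrimeSpectrum.localization_away_comap_range _ (coordX (atInfinity g))]
    exact hP
  obtain ⟨Q, hQ⟩ := h1
  refine ⟨PrimeSpectrum.comap (e.symm : OverlapRing g →+* OverlapRing (atInfinity g)) Q, ?_⟩
  change PrimeSpectrum.comap (infinityTransition g) _ = P
  rw [← hQ, ← he, ← PrimeSpectrum.comap_comp_apply, ← RingHom.comp_assoc, RingEquiv.symm_comp,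
    RingHom.id_comp]

/-- The function `a + b u` on the chart at infinity. -/
def infinityLinear (g : R[X]) (a b : R) : CoordRing (atInfinity g) :=
  algebraMap R _ a + algebraMap R _ b * coordX _

-- The substitution x ↦ a x + b becomes u ↦ u/(a + b u), which is defined only where a + b u is
-- invertible; hence the smaller chart.
section Shrink

variable (g : R[X]) (a b : R)

/-- The coordinate ring of the open part `a + b u ≠ 0` of the chart at infinity. -/
abbrev ShrunkRing : Type u := Localization.Away (infinityLinear g a b)

/-- The coordinate ring of the open part `a + b u ≠ 0` of the overlap. -/
abbrev ShrunkOverlapRing : Type u :=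
  Localization.Away (infinityTransition g (infinityLinear g a b))

/-- The restriction map between the open parts `a + b u ≠ 0`. -/
def shrunkTransition : ShrunkRing g a b →+* ShrunkOverlapRing g a b :=
  IsLocalization.Away.lift (infinityLinear g a b)
    (g := (algebraMap (OverlapRing g) (ShrunkOverlapRing g a b)).comp (infinityTransition g))
    (IsLocalization.Away.algebraMap_isUnit (infinityTransition g (infinityLinear g a b)))

theorem shrunkTransition_comp_algebraMap : (shrunkTransition g a b).comp (algebraMap _ _) =
    (algebraMap (OverlapRing g) (ShrunkOverlapRing g a b)).comp (infinityTransition g) :=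
  IsLocalization.Away.lift_comp _ _

theorem shrunkTransition_algebraMap (z : CoordRing (atInfinity g)) :
    shrunkTransition g a b (algebraMap _ _ z) =
      algebraMap (OverlapRing g) (ShrunkOverlapRing g a b) (infinityTransition g z) :=
  IsLocalization.Away.lift_eq _ _ _

/-- The inclusion of the open part `a + b u ≠ 0` of the chart at infinity. -/
abbrev shrunkInclusion : Spec (CommRingCat.of (ShrunkRing g a b)) ⟶ affineChart (atInfinity g) :=
  Spec.map (CommRingCat.ofHom (algebraMap _ _))

/-- The inclusion of the open part `a + b u ≠ 0` of the overlap. -/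
abbrev shrunkOverlapInclusion : Spec (CommRingCat.of (ShrunkOverlapRing g a b)) ⟶ overlap g :=
  Spec.map (CommRingCat.ofHom (algebraMap _ _))

instance : IsOpenImmersion (shrunkInclusion g a b) :=
  IsOpenImmersion.of_isLocalization (infinityLinear g a b)

theorem isPullback_shrunk : IsPullback (shrunkOverlapInclusion g a b ≫ overlapToAffine g)
    (Spec.map (CommRingCat.ofHom (shrunkTransition g a b))) (affineInclusion g)
    (shrunkInclusion g a b ≫ infinityInclusion g) := by
  have h1 : IsPullback (Spec.map (CommRingCat.ofHom (shrunkTransition g a b)))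
      (shrunkOverlapInclusion g a b) (shrunkInclusion g a b) (overlapToInfinity g) :=
    isPullback_SpecMap_of_isPushout _ _ _ _ (CommRingCat.isPushout_away
    (infinityTransition g) (shrunkTransition g a b) (infinityLinear g a b) _ rfl
    (shrunkTransition_comp_algebraMap g a b))
  exact (h1.paste_vert (isPullback_curve g).flip).flip

variable {a} in
-- Where u vanishes, a + b u reduces to the unit a; points with u non-zero lie in the affine chart
-- anyway. So nothing is lost by shrinking.
theorem range_affineInclusion_union_range_shrunk (ha : IsUnit a) :
    Set.range (affineInclusion g) ∪ Set.range (shrunkInclusion g a b ≫ infinityInclusion g) =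
      Set.univ := by
  rw [Set.eq_univ_iff_forall]
  intro x
  rcases (range_affineInclusion_union_range_infinityInclusion g).symm ▸ Set.mem_univ x
    with hx | ⟨P, rfl⟩
  · exact Or.inl hx
  by_cases hP : coordX (atInfinity g) ∈ P.asIdeal
  · right
    have h1 : (P : PrimeSpectrum (CoordRing (atInfinity g))) ∈
        Set.range (PrimeSpectrum.comap (algebraMap _ (ShrunkRing g a b))) := by
      rw [PrimeSpectrum.localization_away_comap_range _ (infinityLinear g a b)]
      intro hmem
      refine P.isPrime.ne_top (Ideal.eq_top_of_isUnit_mem _ ?_ (ha.map (algebraMap R _)))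
      exact (Ideal.add_mem_iff_left _ (Ideal.mul_mem_left _ _ hP)).1 hmem
    obtain ⟨Q, hQ⟩ := h1
    exact ⟨Q, (Scheme.Hom.comp_apply _ _ _).trans (congrArg (infinityInclusion g) hQ)⟩
  · left
    obtain ⟨Q, rfl⟩ := mem_range_overlapToInfinity g P hP
    refine ⟨overlapToAffine g Q, ?_⟩
    rw [← Scheme.Hom.comp_apply, ← Scheme.Hom.comp_apply, (isPullback_curve g).w]

variable {a} in
theorem isPushout_shrunk (ha : IsUnit a) :
    IsPushout (shrunkOverlapInclusion g a b ≫ overlapToAffine g)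
    (Spec.map (CommRingCat.ofHom (shrunkTransition g a b))) (affineInclusion g)
    (shrunkInclusion g a b ≫ infinityInclusion g) :=
  isPushout_of_isPullback (isPullback_shrunk g a b)
    (range_affineInclusion_union_range_shrunk g b ha)

end Shrink

end Substitution

end Hyperelliptic

/-! ### Isomorphisms given by x ↦ a x + b, y ↦ c y -/

namespace Hyperelliptic

section Substitution

variable {R : Type u} [CommRing R]

/-- This is u/(a + b u) = 1/(a x + b) for u = 1/x, with the inverses given as elements. -/
theorem mul_eq_of_inverses {T : Type*} [CommRing T] {A B U Z W r : T} (h1 : (A * Z + B) * W = 1)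
    (h2 : (A + B * U) * r = 1) (h3 : Z * U = 1) : U * r = W := by
  linear_combination (-U * r) * h1 + W * h2 + (A * r * W) * h3

variable (f g : R[X]) (a b c : R) (h : f.comp (C a * X + C b) = C (c ^ 2) * g)

include h in
theorem substitution_eq : (algebraMap R (CoordRing g) c * coordY g) ^ 2 =
    f.eval₂ (algebraMap R (CoordRing g))
      (algebraMap R (CoordRing g) a * coordX g + algebraMap R (CoordRing g) b) := by
  have h1 := congrArg (eval₂ (algebraMap R (CoordRing g)) (coordX g)) h
  rw [eval₂_comp, eval₂_mul, ← coordY_sq] at h1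
  simpa [mul_pow] using h1.symm

/-- The map of coordinate rings given by the substitution `x ↦ a x + b`, `y ↦ c y`. -/
def substitution : CoordRing f →+* CoordRing g :=
  evalHom f (algebraMap R (CoordRing g)) _ _ (substitution_eq f g a b c h)

@[simp] theorem substitution_coordX : substitution f g a b c h (coordX f) =
    algebraMap R (CoordRing g) a * coordX g + algebraMap R (CoordRing g) b :=
  evalHom_coordX _ _ _ _ _

@[simp] theorem substitution_coordY : substitution f g a b c h (coordY f) =
    algebraMap R (CoordRing g) c * coordY g :=
  evalHom_coordY _ _ _ _ _

@[simp] theorem substitution_algebraMap (r : R) : substitution f g a b c h (algebraMap R _ r) =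
    algebraMap R (CoordRing g) r :=
  evalHom_algebraMap _ _ _ _ _ _

theorem algebraMap_infinityLinear_mul_invSelf :
    (algebraMap R (ShrunkRing g a b) a + algebraMap R (ShrunkRing g a b) b *
      algebraMap (CoordRing (atInfinity g)) (ShrunkRing g a b) (coordX _)) *
      IsLocalization.Away.invSelf (infinityLinear g a b) = 1 := by
  have h1 := IsLocalization.Away.mul_invSelf (S := ShrunkRing g a b) (infinityLinear g a b)
  have h2 : infinityLinear g a b = algebraMap R _ a + algebraMap R _ b * coordX _ := rfl
  have h3 := congrArg (algebraMap (CoordRing (atInfinity g)) (ShrunkRing g a b)) h2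
  rw [map_add, map_mul] at h3
  rw [h3] at h1
  rwa [IsScalarTower.algebraMap_apply R (CoordRing (atInfinity g)) (ShrunkRing g a b) a,
    IsScalarTower.algebraMap_apply R (CoordRing (atInfinity g)) (ShrunkRing g a b) b]

variable (hfg : genus f = genus g)

include h hfg in
-- Replacing x by a x + b and y by c y gives u ↦ u/(a + b u), v ↦ c v/(a + b u)ⁿ⁺¹, where n is the
-- genus; the reversed equation has degree bound 2n + 2, so the denominators cancel.
theorem infinitySubstitution_eq :
    (algebraMap R (ShrunkRing g a b) c * algebraMap _ _ (coordY (atInfinity g)) *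
      IsLocalization.Away.invSelf (infinityLinear g a b) ^ (genus g + 1)) ^ 2 =
    (atInfinity f).eval₂ (algebraMap R (ShrunkRing g a b))
      (algebraMap _ _ (coordX (atInfinity g)) *
        IsLocalization.Away.invSelf (infinityLinear g a b)) := by
  have hN : f.natDegree ≤ 2 * genus g + 2 := hfg ▸ natDegree_le_genus f
  have hf : atInfinity f = f.reflect (2 * genus g + 2) := by rw [atInfinity, hfg]
  rw [hf, eval₂_reflect_comp_linear _ a b _ f hN _ _
    (algebraMap_infinityLinear_mul_invSelf g a b), h, reflect_C_mul, eval₂_mul, eval₂_C]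
  have h1 : algebraMap (CoordRing (atInfinity g)) (ShrunkRing g a b) (coordY _) ^ 2 =
      (reflect (2 * genus g + 2) g).eval₂ (algebraMap R (ShrunkRing g a b))
        (algebraMap _ _ (coordX (atInfinity g))) := by
    rw [← map_pow, coordY_sq, hom_eval₂]
    rfl
  rw [← h1, map_pow]
  ring

/-- The substitution `x ↦ a x + b`, `y ↦ c y` in the coordinates `u = 1 / x`,
`v = y / x ^ (n + 1)`. -/
def infinitySubstitution : CoordRing (atInfinity f) →+* ShrunkRing g a b :=
  evalHom (atInfinity f) (algebraMap R (ShrunkRing g a b)) _ _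
    (infinitySubstitution_eq f g a b c h hfg)

/-- The substitutions on the two charts agree on the overlap: `l` is an extension of the affine one,
which determines the images of 1/x and y/xⁿ⁺¹. -/
theorem shrunkTransition_infinitySubstitution (l : OverlapRing f →+* ShrunkOverlapRing g a b)
    (hl : l.comp (algebraMap _ _) = (algebraMap (OverlapRing g) (ShrunkOverlapRing g a b)).comp
      ((algebraMap _ _).comp (substitution f g a b c h))) :
    (shrunkTransition g a b).comp (infinitySubstitution f g a b c h hfg) =
      l.comp (infinityTransition f) := by
  have hl' : ∀ z, l (algebraMap _ _ z) = algebraMap (OverlapRing g) (ShrunkOverlapRing g a b)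
      (algebraMap _ _ (substitution f g a b c h z)) := fun z ↦ DFunLike.congr_fun hl z
  have hR : ∀ r, shrunkTransition g a b (algebraMap R _ r) = algebraMap (OverlapRing g)
      (ShrunkOverlapRing g a b) (algebraMap R _ r) := by
    intro r
    rw [IsScalarTower.algebraMap_apply R (CoordRing (atInfinity g)) (ShrunkRing g a b),
      shrunkTransition_algebraMap, infinityTransition_algebraMap]
  have hx : shrunkTransition g a b (algebraMap _ _ (coordX (atInfinity g)) *
      IsLocalization.Away.invSelf (infinityLinear g a b)) = l (invX f) := by
    have h1 : l (algebraMap _ _ (coordX f)) * l (invX f) = 1 := by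
      rw [← map_mul, coordX_mul_invX, map_one]
    have h2 := algebraMap_infinityLinear_mul_invSelf g a b
    have h3 := congrArg (shrunkTransition g a b) h2
    simp only [map_mul, map_add, map_one, hR, shrunkTransition_algebraMap,
      infinityTransition_coordX] at h3
    have h4 := congrArg (algebraMap (OverlapRing g) (ShrunkOverlapRing g a b)) (coordX_mul_invX g)
    rw [map_mul, map_one] at h4
    rw [hl', substitution_coordX, map_add, map_mul, map_add, map_mul] at h1
    rw [map_mul, shrunkTransition_algebraMap, infinityTransition_coordX]
    change (algebraMap (OverlapRing g) (ShrunkOverlapRing g a b) (algebraMap R _ a) *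
      algebraMap _ _ (algebraMap _ _ (coordX g)) +
      algebraMap (OverlapRing g) (ShrunkOverlapRing g a b) (algebraMap R _ b)) * l (invX f) = 1
      at h1
    exact mul_eq_of_inverses h1 h3 h4
  refine coordRing_hom_ext ?_ ?_ ?_
  · ext r
    simp only [RingHom.comp_apply, infinitySubstitution, evalHom_algebraMap, hR,
      infinityTransition_algebraMap]
    have h1 := hl' (algebraMap R _ r)
    rw [substitution_algebraMap] at h1
    exact h1.symm
  · simp only [RingHom.comp_apply, infinitySubstitution, evalHom_coordX,
      infinityTransition_coordX, hx]
  · have h1 : l (infinityTransition f (coordY _)) = algebraMap R (ShrunkOverlapRing g a b) c *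
      algebraMap _ _ (algebraMap (CoordRing g) (OverlapRing g) (coordY g)) * l (invX f) ^ (genus g + 1) := by
      rw [infinityTransition_coordY, map_mul, map_pow, hl', substitution_coordY, hfg, map_mul,
        map_mul]
      rfl
    simp only [RingHom.comp_apply]
    rw [h1, ← hx, infinitySubstitution, evalHom_coordY, map_mul, map_mul, map_pow, map_mul, hR,
      shrunkTransition_algebraMap, shrunkTransition_algebraMap, infinityTransition_coordX,
      infinityTransition_coordY, map_mul, map_pow, mul_pow]
    rw [IsScalarTower.algebraMap_apply R (OverlapRing g) (ShrunkOverlapRing g a b)]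
    ring

include hfg in
/-- The morphism of complete curves given by the substitution `x ↦ a x + b`, `y ↦ c y`. -/
theorem exists_substitutionMorphism (ha : IsUnit a) : ∃ θ : curve g ⟶ curve f,
    affineInclusion g ≫ θ =
      Spec.map (CommRingCat.ofHom (substitution f g a b c h)) ≫ affineInclusion f ∧
    θ ≫ curveStr f = curveStr g := by
  obtain ⟨l, hl⟩ : ∃ l : OverlapRing f →+* ShrunkOverlapRing g a b,
      l.comp (algebraMap _ _) = (algebraMap (OverlapRing g) (ShrunkOverlapRing g a b)).comp
      ((algebraMap _ _).comp (substitution f g a b c h)) := by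
    refine ⟨IsLocalization.Away.lift (coordX f) (g := (algebraMap (OverlapRing g)
      (ShrunkOverlapRing g a b)).comp ((algebraMap _ _).comp (substitution f g a b c h))) ?_,
      IsLocalization.Away.lift_comp _ _⟩
    have h2 := congrArg (algebraMap (OverlapRing g) (ShrunkOverlapRing g a b)) (coordX_mul_invX g)
    have h3 := IsLocalization.Away.algebraMap_isUnit (S := ShrunkOverlapRing g a b)
      (infinityTransition g (infinityLinear g a b))
    -- On the overlap a x + b = x (a + b u), a product of two elements that are inverted.
    have h4 : algebraMap (OverlapRing g) (ShrunkOverlapRing g a b)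
        (algebraMap (CoordRing g) (OverlapRing g) (substitution f g a b c h (coordX f))) =
        algebraMap _ _ (algebraMap (CoordRing g) (OverlapRing g) (coordX g)) *
          algebraMap _ _ (infinityTransition g (infinityLinear g a b)) := by
      rw [← map_mul]
      congr 1
      rw [substitution_coordX, infinityLinear, map_add, map_mul, map_add, map_mul,
        infinityTransition_coordX, infinityTransition_algebraMap, infinityTransition_algebraMap,
        IsScalarTower.algebraMap_apply R (CoordRing g) (OverlapRing g) a,
        IsScalarTower.algebraMap_apply R (CoordRing g) (OverlapRing g) b]
      linear_combination (-algebraMap (CoordRing g) (OverlapRing g) (algebraMap R _ b)) *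
        coordX_mul_invX g
    change IsUnit (algebraMap (OverlapRing g) (ShrunkOverlapRing g a b)
        (algebraMap (CoordRing g) (OverlapRing g) (substitution f g a b c h (coordX f))))
    rw [h4]
    rw [map_mul, map_one] at h2
    exact (IsUnit.of_mul_eq_one _ h2).mul h3
  have hw : (shrunkOverlapInclusion g a b ≫ overlapToAffine g) ≫
      (Spec.map (CommRingCat.ofHom (substitution f g a b c h)) ≫ affineInclusion f) =
      Spec.map (CommRingCat.ofHom (shrunkTransition g a b)) ≫
      (Spec.map (CommRingCat.ofHom (infinitySubstitution f g a b c h hfg)) ≫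
        infinityInclusion f) := by
    have hs : ∀ {A B D : Type u} [CommRing A] [CommRing B] [CommRing D] (x : A →+* B)
        (y : B →+* D), Spec.map (CommRingCat.ofHom y) ≫ Spec.map (CommRingCat.ofHom x) =
        Spec.map (CommRingCat.ofHom (y.comp x)) := fun x y ↦ by
      rw [← Spec.map_comp, ← CommRingCat.ofHom_comp]
    have h1 : shrunkOverlapInclusion g a b ≫ overlapToAffine g ≫
        Spec.map (CommRingCat.ofHom (substitution f g a b c h)) =
        Spec.map (CommRingCat.ofHom l) ≫ overlapToAffine f := by
      rw [hs, hs, hs, hl]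
    have h2 : Spec.map (CommRingCat.ofHom (shrunkTransition g a b)) ≫
        Spec.map (CommRingCat.ofHom (infinitySubstitution f g a b c h hfg)) =
        Spec.map (CommRingCat.ofHom l) ≫ overlapToInfinity f := by
      rw [overlapToInfinity_eq, hs, hs, shrunkTransition_infinitySubstitution f g a b c h hfg l hl]
    rw [reassoc_of% h2, Category.assoc, reassoc_of% h1, (isPullback_curve f).w]
  have P := isPushout_shrunk g b ha
  refine ⟨P.desc _ _ hw, P.inl_desc _ _ hw, P.hom_ext ?_ ?_⟩
  · rw [P.inl_desc_assoc, Category.assoc, affineInclusion_curveStr, affineInclusion_curveStr,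
      ← Spec.map_comp, ← CommRingCat.ofHom_comp]
    congr 2
    ext r
    simp
  · rw [P.inr_desc_assoc, Category.assoc, Category.assoc, infinityInclusion_curveStr,
      infinityInclusion_curveStr,
      ← Spec.map_comp, ← Spec.map_comp, ← CommRingCat.ofHom_comp, ← CommRingCat.ofHom_comp]
    congr 2
    ext r
    simp only [RingHom.comp_apply, infinitySubstitution, evalHom_algebraMap]
    rfl

include hfg in
/-- An invertible substitution `x ↦ a x + b`, `y ↦ c y` defines an isomorphism of complete
curves. -/
theorem exists_substitutionIso (ha : IsUnit a) (hc : IsUnit c) : ∃ e : curve g ≅ curve f,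
    affineInclusion g ≫ e.hom =
      Spec.map (CommRingCat.ofHom (substitution f g a b c h)) ≫ affineInclusion f ∧
    e.hom ≫ curveStr f = curveStr g := by
  obtain ⟨a', ha'⟩ := ha.exists_right_inv
  obtain ⟨c', hc'⟩ := hc.exists_right_inv
  -- The inverse substitution, x ↦ (x - b)/a and y ↦ y/c.
  have h' : g.comp (C a' * X + C (-(a' * b))) = C (c' ^ 2) * f := by
    have h1 : f = (C (c ^ 2) * g).comp (C a' * X + C (-(a' * b))) := by
      rw [← h, comp_assoc]
      have h2 : (C a * X + C b).comp (C a' * X + C (-(a' * b))) = X := by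
        simp only [add_comp, mul_comp, C_comp, X_comp]
        have h3 : a * -(a' * b) = -b := by linear_combination (-b) * ha'
        rw [mul_add, ← mul_assoc, ← C_mul, ← C_mul, ha', h3]
        simp
      rw [h2, comp_X]
    have h3 : c' ^ 2 * c ^ 2 = 1 := by rw [← mul_pow, mul_comm, hc', one_pow]
    conv_rhs => rw [h1, mul_comp, C_comp, ← mul_assoc, ← C_mul, h3, C_1, one_mul]
  obtain ⟨θ, h1, h2⟩ := exists_substitutionMorphism f g a b c h hfg ha
  obtain ⟨η, h3, h4⟩ := exists_substitutionMorphism g f a' (-(a' * b)) c' h' hfg.symm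
    (IsUnit.of_mul_eq_one_right _ ha')
  have ida : ∀ (k k' : R[X]) (x y z x' y' z' : R) (hk) (hk') (hx : x * x' = 1)
      (hy : x' * y + y' = 0) (hz : z * z' = 1),
      Spec.map (CommRingCat.ofHom (substitution k k' x y z hk)) ≫
        Spec.map (CommRingCat.ofHom (substitution k' k x' y' z' hk')) = 𝟙 _ := by
    intro k k' x y z x' y' z' hk hk' hx hy hz
    rw [← Spec.map_comp, ← CommRingCat.ofHom_comp, ← Spec.map_id]
    congr 1
    ext1
    refine coordRing_hom_ext ?_ ?_ ?_
    · ext r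
      simp
    · change substitution k k' x y z hk (substitution k' k x' y' z' hk' (coordX k')) = coordX k'
      simp only [substitution_coordX, map_add, map_mul,
        substitution_algebraMap]
      replace hx := congrArg (algebraMap R (CoordRing k')) hx
      replace hy := congrArg (algebraMap R (CoordRing k')) hy
      simp only [map_mul, map_add, map_one, map_zero] at hx hy
      linear_combination coordX k' * hx + hy
    · change substitution k k' x y z hk (substitution k' k x' y' z' hk' (coordY k')) = coordY k'
      simp only [substitution_coordY, map_mul, substitution_algebraMap]
      replace hz := congrArg (algebraMap R (CoordRing k')) hz
      simp only [map_mul, map_one] at hz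
      linear_combination coordY k' * hz
  refine ⟨⟨θ, η, ?_, ?_⟩, h1, h2⟩
  -- The curve is separated over the base, so it suffices to compare on the affine chart; nothing
  -- has to be computed at infinity.
  · refine curve_hom_ext_of_isSeparated g (curveStr g) ?_ ?_
    · rw [Category.assoc, h4, h2, Category.id_comp]
    · rw [reassoc_of% h1, h3, Category.comp_id, ← Category.assoc,
        ida f g a b c a' _ c' _ _ ha' (by ring) hc']
      exact Category.id_comp _
  · refine curve_hom_ext_of_isSeparated f (curveStr f) ?_ ?_
    · rw [Category.assoc, h2, h4, Category.id_comp]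
    · rw [reassoc_of% h3, h1, Category.comp_id, ← Category.assoc,
        ida g f a' _ c' a b c _ _ (by rw [mul_comm, ha']) (by linear_combination (-b) * ha')
        (by rw [mul_comm, hc'])]
      exact Category.id_comp _

end Substitution

end Hyperelliptic

/-! ### Integral models from a substitution over the fraction field -/

namespace Hyperelliptic

section Model

/-- A polynomial over `R` which, over the field of fractions, is related to `f` by a linear
substitution defines an integral model. -/
theorem exists_integralModel {R K F : Type u} [CommRing R] [Field K] [Field F] (ι : R →+* F)
    (φ : K →+* F) (f : K[X]) (g : R[X]) (a b c : F) (ha : a ≠ 0) (hc : c ≠ 0)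
    (hf : genus (f.map φ) = genus f) (hg : genus (g.map ι) = genus g)
    (hfg : genus (f.map φ) = genus (g.map ι))
    (h : (f.map φ).comp (C a * X + C b) = C (c ^ 2) * g.map ι) :
    ∃ M : IntegralModel ι (baseChangeStr φ f) (curveStr g),
      affineToBaseChange ι g ≫ M.genericIso.hom =
        Spec.map (CommRingCat.ofHom (substitution (f.map φ) (g.map ι) a b c h)) ≫
          affineToBaseChange φ f := by
  obtain ⟨e, he1, he2⟩ := exists_substitutionIso (f.map φ) (g.map ι) a b c h hfg ha.isUnit
    hc.isUnit
  refine ⟨⟨inferInstance, inferInstance,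
    -- From the generic fibre of the model to the curve of the image of g, then by the substitution
    -- to the curve of the image of f, then to the base change of X.
    (curveIsoBaseChange ι g hg).symm ≪≫ e ≪≫ curveIsoBaseChange φ f hf, ?_⟩, ?_⟩
  · simp only [Iso.trans_hom, Iso.symm_hom, Category.assoc]
    rw [curveIsoBaseChange_hom_str, he2, Iso.inv_comp_eq, curveIsoBaseChange_hom_str]
  · simp only [Iso.trans_hom, Iso.symm_hom]
    rw [reassoc_of% affineToBaseChange_curveIsoBaseChange_inv, reassoc_of% he1,
      affineInclusion_curveIsoBaseChange_hom]

theorem exists_baseChangeIso {R k : Type u} [CommRing R] [CommRing k] (φ : R →+* k) (g : R[X])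
    (q : k[X]) (hq : g.map φ = q) (hg : genus (g.map φ) = genus g) :
    ∃ e : baseChange φ g ≅ curve q, e.hom ≫ curveStr q = baseChangeStr φ g := by
  subst hq
  exact ⟨(curveIsoBaseChange φ g hg).symm, by
    rw [Iso.symm_hom, Iso.inv_comp_eq, curveIsoBaseChange_hom_str]⟩

end Model

end Hyperelliptic

/-! ### Ramification in finite extensions of discrete valuation rings -/

section LocalExtension

variable (R S K L : Type*) [CommRing R] [IsDomain R] [IsDiscreteValuationRing R]
  [CommRing S] [IsDomain S] [IsDiscreteValuationRing S] [Algebra R S] [Module.Finite R S]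

open IsLocalRing

theorem bijective_residueFieldMap_of_inertiaDeg_eq_one [IsLocalHom (algebraMap R S)]
    (h : (maximalIdeal S).inertiaDeg R = 1) :
    Function.Bijective (ResidueField.map (algebraMap R S)) := by
  rw [Ideal.inertiaDeg_eq_of_isMaximal (maximalIdeal R) (maximalIdeal S)] at h
  have h' : Module.finrank (ResidueField R) (ResidueField S) = 1 := h
  exact Algebra.bijective_algebraMap_iff.2 (Subalgebra.bot_eq_top_of_finrank_eq_one h').symm

variable [Module.IsTorsionFree R S]

instance maximalIdeal_liesOver_maximalIdeal :
    (maximalIdeal S).LiesOver (maximalIdeal R) := by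
  constructor
  have : Algebra.IsIntegral R S := inferInstance
  have : ((maximalIdeal S).comap (algebraMap R S)).IsMaximal :=
    Ideal.isMaximal_comap_of_isIntegral_of_isMaximal (R := R) (maximalIdeal S)
  exact (IsLocalRing.eq_maximalIdeal this).symm

omit [Module.IsTorsionFree R S] in
theorem primesOver_maximalIdeal_eq :
    (maximalIdeal R).primesOver S = {maximalIdeal S} := by
  ext P
  constructor
  · rintro ⟨h, h'⟩
    have : P.IsMaximal := Ideal.isMaximal_of_isIntegral_of_isMaximal_comap (R := R) P
      (by rw [← Ideal.under_def, ← h'.over]; infer_instance)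
    exact IsLocalRing.eq_maximalIdeal this
  · rintro rfl
    exact ⟨inferInstance, inferInstance⟩

/-- Only one prime of S lies over the maximal ideal of R, so the fundamental identity ∑ e f = n has
a single term. -/
theorem ramificationIdx_mul_inertiaDeg_maximalIdeal :
    (maximalIdeal S).ramificationIdx R * (maximalIdeal S).inertiaDeg R = Module.finrank R S := by
  have hP := primesOver_maximalIdeal_eq R S
  let _ : Unique ((maximalIdeal R).primesOver S) :=
    { default := ⟨maximalIdeal S, by rw [hP]; rfl⟩
      uniq := fun ⟨Q, hQ⟩ ↦ Subtype.ext (by rw [hP] at hQ; exact hQ) }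
  have := Ideal.sum_ramification_inertia_eq_finrank (maximalIdeal R) S
  rw [Fintype.sum_unique] at this
  exact this

variable [Field K] [Field L] [Algebra R K] [IsFractionRing R K] [Algebra S L] [IsFractionRing S L]
  [Algebra K L] [Algebra R L] [IsScalarTower R K L] [IsScalarTower R S L]

theorem valuation_algebraMap_maximalIdeal (x : K) :
    (IsDiscreteValuationRing.maximalIdeal S).valuation L (algebraMap K L x) =
      (IsDiscreteValuationRing.maximalIdeal R).valuation K x ^
        (maximalIdeal S).ramificationIdx R := by
  have : (IsDiscreteValuationRing.maximalIdeal S).asIdeal.LiesOver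
    (IsDiscreteValuationRing.maximalIdeal R).asIdeal := maximalIdeal_liesOver_maximalIdeal R S
  rw [← IsDedekindDomain.HeightOneSpectrum.valuation_liesOver L
    (IsDiscreteValuationRing.maximalIdeal R), Ideal.ramificationIdx'_eq_ramificationIdx]
  · rfl
  · exact (IsDiscreteValuationRing.maximalIdeal R).ne_bot

/-- Finiteness of the residue field enters through perfectness: it makes the order of inertia equal
to e without an inseparable factor. -/
theorem card_inertia_maximalIdeal [Finite (ResidueField R)] (G : Type*) [Group G] [Finite G]
    [MulSemiringAction G S] [IsGaloisGroup G R S] :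
    Nat.card ((maximalIdeal S).inertia G) = (maximalIdeal S).ramificationIdx R := by
  have : Finite (R ⧸ maximalIdeal R) := ‹Finite (ResidueField R)›
  have : Finite (maximalIdeal R).ResidueField :=
    Finite.of_surjective _
      (Ideal.bijective_algebraMap_quotient_residueField (maximalIdeal R)).surjective
  have : PerfectField (maximalIdeal R).ResidueField := inferInstance
  rw [Ideal.card_inertia_eq_ramificationIdxIn (maximalIdeal R),
    Ideal.ramificationIdxIn_eq_ramificationIdx (maximalIdeal R) (maximalIdeal S) G]

end LocalExtension
-- Rings of integers and ramification indices over ℚ_p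
namespace PadicField

variable (p : ℕ) [Fact p.Prime]

section
variable (K : Type u) [Field K] [Algebra ℚ_[p] K] [Algebra.IsAlgebraic ℚ_[p] K]

instance : Algebra ℤ_[p] (integers p K) :=
  ((intMap p K).codRestrict (integers p K) fun _ ↦ RingHom.isIntegralElem_map _).toAlgebra

instance : Algebra ℤ_[p] K := (intMap p K).toAlgebra

instance : IsScalarTower ℤ_[p] (integers p K) K := IsScalarTower.of_algebraMap_eq fun _ ↦ rfl

instance : IsScalarTower ℤ_[p] ℚ_[p] K := IsScalarTower.of_algebraMap_eq fun _ ↦ rfl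

instance : IsIntegralClosure (integers p K) ℤ_[p] K where
  algebraMap_injective := Subtype.val_injective
  isIntegral_iff {x} := ⟨fun h ↦ ⟨⟨x, h⟩, rfl⟩, by rintro ⟨y, rfl⟩; exact y.2⟩

instance : IsLocalHom (algebraMap ℤ_[p] (integers p K)) := by
  have : Algebra.IsIntegral ℤ_[p] (integers p K) := IsIntegralClosure.isIntegral_algebra ℤ_[p] K
  have : FaithfulSMul ℤ_[p] (integers p K) := by
    rw [faithfulSMul_iff_algebraMap_injective]
    intro a b h
    have := congrArg Subtype.val h
    exact Subtype.ext ((algebraMap ℚ_[p] K).injective this)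
  infer_instance

theorem natCast_mem_maximalIdeal : (p : integers p K) ∈ IsLocalRing.maximalIdeal (integers p K) := by
  rw [IsLocalRing.mem_maximalIdeal, mem_nonunits_iff, ← map_natCast (algebraMap ℤ_[p] _),
    isUnit_map_iff]
  exact PadicInt.prime_p.not_isUnit

instance : CharP (residueField p K) p := by
  refine (CharP.charP_iff_prime_eq_zero Fact.out).2 ?_
  rw [← map_natCast (IsLocalRing.residue (integers p K)), IsLocalRing.residue_eq_zero_iff]
  exact natCast_mem_maximalIdeal p K
end

section
variable (K : Type u) [Field K] [Algebra ℚ_[p] K] [FiniteDimensional ℚ_[p] K]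

instance : Module.Finite ℤ_[p] (integers p K) :=
  IsIntegralClosure.finite ℤ_[p] ℚ_[p] K (integers p K)

instance : Finite (residueField p K) :=
  IsLocalRing.ResidueField.finite_of_finite (R := ℤ_[p]) inferInstance

end

section
variable (K L : Type u) [Field K] [Algebra ℚ_[p] K] [Algebra.IsAlgebraic ℚ_[p] K] [Field L]
  [Algebra ℚ_[p] L] [Algebra.IsAlgebraic ℚ_[p] L] [Algebra K L] [IsScalarTower ℚ_[p] K L]

instance : Algebra (integers p K) (integers p L) := (integersMap p K L).toAlgebra

instance : IsScalarTower (integers p K) (integers p L) L := IsScalarTower.of_algebraMap_eq fun _ ↦ rfl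

instance : IsScalarTower ℤ_[p] (integers p K) L := IsScalarTower.of_algebraMap_eq fun x ↦
  IsScalarTower.algebraMap_apply ℚ_[p] K L x

instance : IsIntegralClosure (integers p L) (integers p K) L where
  algebraMap_injective := Subtype.val_injective
  isIntegral_iff {x} := by
    have : Algebra.IsIntegral ℤ_[p] (integers p K) := IsIntegralClosure.isIntegral_algebra ℤ_[p] K
    constructor
    · intro h
      exact ⟨⟨x, isIntegral_trans (R := ℤ_[p]) (A := integers p K) x h⟩, rfl⟩
    · rintro ⟨y, rfl⟩
      exact IsIntegral.tower_top (R := ℤ_[p]) (A := integers p K) y.2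

instance : Module.IsTorsionFree (integers p K) (integers p L) := by
  have : FaithfulSMul (integers p K) (integers p L) := by
    rw [faithfulSMul_iff_algebraMap_injective]
    intro a b h
    exact Subtype.ext ((algebraMap K L).injective (congrArg Subtype.val h))
  infer_instance

end

section
variable (K L : Type u) [Field K] [Algebra ℚ_[p] K] [FiniteDimensional ℚ_[p] K] [Field L]
  [Algebra ℚ_[p] L] [FiniteDimensional ℚ_[p] L] [Algebra K L] [IsScalarTower ℚ_[p] K L]

instance : Module.Finite (integers p K) (integers p L) :=
  have : FiniteDimensional K L := .right ℚ_[p] K L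
  have : CharZero K := charZero_of_injective_algebraMap (algebraMap ℚ_[p] K).injective
  IsIntegralClosure.finite (integers p K) K L (integers p L)

/-- The ramification index of an extension of finite extensions of `ℚ_p`. -/
def ramificationIndex : ℕ :=
  (IsLocalRing.maximalIdeal (integers p L)).ramificationIdx (integers p K)

theorem normalizedVal_algebraMap (x : K) :
    normalizedVal p L (algebraMap K L x) = ramificationIndex p K L * normalizedVal p K x := by
  rw [normalizedVal, valuation_algebraMap_maximalIdeal (integers p K) (integers p L),
    WithZero.log_pow, normalizedVal, ramificationIndex, nsmul_eq_mul, mul_neg]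

/-- The witness is the inertia degree; all that is used of it later is what its being 1 implies. -/
theorem exists_ramificationIndex_mul_eq_finrank : ∃ f : ℕ,
    ramificationIndex p K L * f = Module.finrank K L ∧
      (f = 1 → Function.Bijective (residueFieldMap p K L)) := by
  refine ⟨_, (ramificationIdx_mul_inertiaDeg_maximalIdeal _ _).trans
    (IsFractionRing.finrank_eq _ K _ L).symm, fun h ↦ ?_⟩
  exact bijective_residueFieldMap_of_inertiaDeg_eq_one _ _ h

/-- Both sides are the valuation in M of a uniformiser of K. -/
theorem ramificationIndex_tower (M : Type u) [Field M] [Algebra ℚ_[p] M] [FiniteDimensional ℚ_[p] M]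
    [Algebra K M] [IsScalarTower ℚ_[p] K M] [Algebra L M] [IsScalarTower ℚ_[p] L M]
    [IsScalarTower K L M] :
    ramificationIndex p K L * ramificationIndex p L M = ramificationIndex p K M := by
  obtain ⟨π, hπ⟩ := (IsDiscreteValuationRing.maximalIdeal (integers p K)).valuation_exists_uniformizer K
  have h1 : normalizedVal p K π = 1 := by simp [normalizedVal, hπ]
  have h := normalizedVal_algebraMap p K M π
  rw [IsScalarTower.algebraMap_apply K L M, normalizedVal_algebraMap, normalizedVal_algebraMap, h1] at h
  zify
  linarith

end

end PadicField

/-! ### The Galois action on the ring of integers -/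

namespace PadicField

variable (p : ℕ) [Fact p.Prime] (K L : Type u) [Field K] [Algebra ℚ_[p] K]
  [Field L] [Algebra ℚ_[p] L] [Algebra K L] [IsScalarTower ℚ_[p] K L]

section
variable [Algebra.IsAlgebraic ℚ_[p] K] [Algebra.IsAlgebraic ℚ_[p] L] [Algebra.IsAlgebraic K L]

instance : MulSemiringAction Gal(L/K) (integers p L) :=
  IsIntegralClosure.MulSemiringAction (integers p K) K L (integers p L)

@[simp]
theorem coe_galois_smul (σ : Gal(L/K)) (x : integers p L) : ((σ • x : integers p L) : L) = σ x :=
  algebraMap_galRestrict_apply (integers p K) σ x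

end

variable [FiniteDimensional ℚ_[p] K] [FiniteDimensional ℚ_[p] L] [FiniteDimensional K L]

instance [IsGalois K L] : IsGaloisGroup Gal(L/K) (integers p K) (integers p L) :=
  have : SMulDistribClass Gal(L/K) (integers p L) L := ⟨fun σ x y ↦ by
    simp [Algebra.smul_def]⟩
  IsGaloisGroup.of_isFractionRing Gal(L/K) (integers p K) (integers p L) K L

theorem card_inertia_eq_ramificationIndex [IsGalois K L] :
    Nat.card ((IsLocalRing.maximalIdeal (integers p L)).inertia Gal(L/K)) =
      ramificationIndex p K L :=
  card_inertia_maximalIdeal (integers p K) (integers p L) Gal(L/K)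

end PadicField

/-! ### Transitive actions of prime degree -/

section PrimeDegreeAction

variable {G X : Type*} [Group G] [MulAction G X] {p : ℕ}

theorem MulAction.IsPretransitive.card_dvd [Finite G] [MulAction.IsPretransitive G X] [Nonempty X] :
    Nat.card X ∣ Nat.card G := by
  obtain ⟨x⟩ := ‹Nonempty X›
  rw [← MulAction.index_stabilizer_of_transitive G x]
  exact Subgroup.index_dvd_card _

/-- A transitive action on a prime number of points is primitive, so a normal subgroup that does not
act trivially is transitive; faithfulness excludes the trivial action. -/
theorem prime_dvd_card_of_normal [Finite G] [MulAction.IsPretransitive G X] [FaithfulSMul G X]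
    (hp : (Nat.card X).Prime) (N : Subgroup G) [N.Normal] (hN : N ≠ ⊥) :
    Nat.card X ∣ Nat.card N := by
  have := MulAction.IsPreprimitive.of_prime_card (G := G) hp
  have : Nonempty X := (Nat.card_ne_zero.1 hp.ne_zero).1
  have : MulAction.IsPretransitive N X := by
    refine MulAction.IsQuasiPreprimitive.isPretransitive_of_normal fun h ↦ hN ?_
    rw [Subgroup.eq_bot_iff_forall]
    refine fun n hn ↦ FaithfulSMul.eq_of_smul_eq_smul (α := X) fun x ↦ ?_
    have hx : x ∈ MulAction.fixedPoints N X := h ▸ Set.mem_univ x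
    rw [one_smul]
    exact hx ⟨n, hn⟩
  exact MulAction.IsPretransitive.card_dvd

/-- An element of prime order p acting faithfully on p points moves some point, whose orbit then has
p elements: it is a p-cycle. -/
theorem exists_pow_smul_eq_of_orderOf_eq_prime [FaithfulSMul G X] (hp : (Nat.card X).Prime) {σ : G}
    (hσ : orderOf σ = Nat.card X) (x y : X) : ∃ j < Nat.card X, σ ^ j • x = y := by
  have : Finite X := (Nat.card_ne_zero.1 hp.ne_zero).2
  obtain ⟨z, hz⟩ : ∃ z : X, σ • z ≠ z := by
    by_contra! h
    have : σ = 1 := FaithfulSMul.eq_of_smul_eq_smul (α := X) fun x ↦ by rw [h, one_smul]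
    rw [this, orderOf_one] at hσ
    exact hp.one_lt.ne hσ
  have hper : MulAction.period σ z = Nat.card X := by
    refine (hp.eq_one_or_self_of_dvd _ (hσ ▸ MulAction.period_dvd_orderOf σ z)).resolve_left
      fun h ↦ hz ?_
    simpa using (MulAction.pow_smul_eq_iff_period_dvd (m := σ) (a := z) (n := 1)).2 (by rw [h])
  have hinj : Function.Injective fun j : Fin (Nat.card X) ↦ σ ^ (j : ℕ) • z := by
    intro i j hij
    wlog hle : i ≤ j generalizing i j
    · exact (this hij.symm (le_of_not_ge hle)).symm
    have h1 : σ ^ ((j : ℕ) - i) • z = z := by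
      have : σ ^ (i : ℕ) • σ ^ ((j : ℕ) - i) • z = σ ^ (i : ℕ) • z := by
        rw [smul_smul, ← pow_add, Nat.add_sub_cancel' hle]
        exact hij.symm
      exact MulAction.injective _ this
    rw [MulAction.pow_smul_eq_iff_period_dvd, hper] at h1
    have := Nat.eq_zero_of_dvd_of_lt h1 (by lia)
    exact Fin.ext (by lia)
  have hsurj := (hinj.bijective_of_nat_card_le (by simp)).surjective
  obtain ⟨a, rfl⟩ := hsurj x
  obtain ⟨b, rfl⟩ := hsurj y
  -- With x = σᵃz and y = σᵇz the exponent is b - a modulo p.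
  refine ⟨(b + (Nat.card X - a)) % Nat.card X, Nat.mod_lt _ hp.pos, ?_⟩
  have hmod (m : ℕ) : σ ^ (m % Nat.card X) = σ ^ m := by rw [← hσ, pow_mod_orderOf]
  have hone : σ ^ Nat.card X = 1 := by rw [← hσ, pow_orderOf_eq_one]
  simp only
  rw [hmod, smul_smul, ← pow_add, add_assoc, Nat.sub_add_cancel a.2.le, pow_add, hone, mul_one]

end PrimeDegreeAction

/-! ### Galois action on roots, and the discriminant -/

section

variable {K L : Type*} [Field K] [Field L] [Algebra K L] {f : K[X]}

instance IsGalois.isPretransitive_rootSet [Normal K L] [Fact (Irreducible f)] :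
    MulAction.IsPretransitive Gal(L/K) (f.rootSet L) := by
  refine ⟨fun x y ↦ ?_⟩
  have hx := minpoly.eq_of_irreducible Fact.out (mem_rootSet.1 x.2).2
  have hy := minpoly.eq_of_irreducible Fact.out (mem_rootSet.1 y.2).2
  obtain ⟨σ, hσ⟩ := (Normal.minpoly_eq_iff_mem_orbit L).1 (hy.symm.trans hx)
  exact ⟨σ, Subtype.ext hσ⟩

theorem faithfulSMul_rootSet (h : IntermediateField.adjoin K (f.rootSet L) = ⊤) :
    FaithfulSMul Gal(L/K) (f.rootSet L) := by
  refine ⟨fun {σ τ} hστ ↦ ?_⟩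
  have hle : IntermediateField.adjoin K (f.rootSet L) ≤
      IntermediateField.fixedField (Subgroup.zpowers (τ⁻¹ * σ)) := by
    rw [IntermediateField.adjoin_le_iff]
    rintro x hx ⟨g, hg⟩
    obtain ⟨n, rfl⟩ := Subgroup.mem_zpowers_iff.1 hg
    have h1 : τ⁻¹ * σ ∈ MulAction.stabilizer Gal(L/K) x := by
      rw [MulAction.mem_stabilizer_iff, mul_smul, inv_smul_eq_iff]
      exact congrArg Subtype.val (hστ ⟨x, hx⟩)
    exact zpow_mem h1 n
  refine AlgEquiv.ext fun x ↦ ?_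
  have hx : x ∈ IntermediateField.fixedField (Subgroup.zpowers (τ⁻¹ * σ)) :=
    hle (h ▸ IntermediateField.mem_top)
  have h1 : (τ⁻¹ * σ) • x = x := hx ⟨_, Subgroup.mem_zpowers _⟩
  rwa [mul_smul, inv_smul_eq_iff] at h1

theorem exists_pow_apply_eq [FaithfulSMul Gal(L/K) (f.rootSet L)] {p : ℕ} [Fact p.Prime]
    (hcard : Nat.card (f.rootSet L) = p) {σ : Gal(L/K)} (hσ : orderOf σ = p) {α β : L}
    (hα : α ∈ f.rootSet L) (hβ : β ∈ f.rootSet L) : ∃ j < p, (σ ^ j) α = β := by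
  obtain ⟨j, hj, h⟩ := exists_pow_smul_eq_of_orderOf_eq_prime (hcard ▸ Fact.out)
    (hσ.trans hcard.symm) (⟨α, hα⟩ : f.rootSet L) ⟨β, hβ⟩
  exact ⟨j, hcard ▸ hj, congrArg Subtype.val h⟩

theorem eq_prod_X_sub_C_of_injOn {ι : Type*} {g : L[X]} (hg : g.Monic) (s : Finset ι) (r : ι → L)
    (hr : Set.InjOn r s) (hroot : ∀ i ∈ s, g.IsRoot (r i)) (hcard : g.natDegree = s.card) :
    g = ∏ i ∈ s, (X - C (r i)) := by
  have hnd : (s.val.map r).Nodup := (Multiset.nodup_map_iff_inj_on s.nodup).2 fun x hx y hy h ↦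
    hr hx hy h
  have hle : s.val.map r ≤ g.roots := (Multiset.le_iff_subset hnd).2 fun x hx ↦ by
    obtain ⟨i, hi, rfl⟩ := Multiset.mem_map.1 hx
    exact (mem_roots hg.ne_zero).2 (hroot i hi)
  have hroots : s.val.map r = g.roots := Multiset.eq_of_le_of_card_le hle (by
    rw [Multiset.card_map]
    exact (card_roots' g).trans hcard.le)
  have h := prod_multiset_X_sub_C_of_monic_of_roots_card_eq hg (by
    rw [← hroots, Multiset.card_map, hcard]; rfl)
  rw [← h, ← hroots, Multiset.map_map]
  rfl

theorem natCast_injOn_range (k : Type*) [Field k] (p : ℕ) [CharP k p] :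
    Set.InjOn (fun j : ℕ ↦ (j : k)) (Finset.range p) := by
  intro i hi j hj h
  exact CharP.natCast_injOn_Iio k p (by simpa using hi) (by simpa using hj) h

theorem X_pow_sub_X_eq_prod (k : Type*) [Field k] (p : ℕ) [Fact p.Prime] [CharP k p] :
    X ^ p - X = ∏ j ∈ Finset.range p, (X - C (j : k)) := by
  have hp : 1 < p := (Fact.out : p.Prime).one_lt
  refine eq_prod_X_sub_C_of_injOn (monic_X_pow_sub (by simpa using hp)) _ _
    (natCast_injOn_range k p) (fun j _ ↦ ?_) ?_
  · rw [IsRoot.def, eval_sub, eval_pow, eval_X, ← frobenius_def, map_natCast, sub_self]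
  · rw [FiniteField.X_pow_card_sub_X_natDegree_eq k hp, Finset.card_range]

/-- Up to sign the discriminant of a monic f is the product of f'(α) over its roots, and each f'(α)
is a product of n - 1 differences of roots. -/
theorem valuation_discr {Γ : Type*} [LinearOrderedCommGroupWithZero Γ] (v : Valuation L Γ)
    (hf : f.Monic) (hdeg : 0 < f.natDegree) (hs : (f.map (algebraMap K L)).Splits)
    (hsep : f.Separable) (c : Γ)
    (hv : ∀ α ∈ f.rootSet L, ∀ β ∈ f.rootSet L, α ≠ β → v (α - β) = c) :
    v (algebraMap K L f.discr) = c ^ (f.natDegree * (f.natDegree - 1)) := by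
  classical
  set g := f.map (algebraMap K L) with hg
  have hgm : g.Monic := hf.map _
  have hgd : g.natDegree = f.natDegree := natDegree_map _
  have hnd : g.roots.Nodup := nodup_roots hsep.map
  have hcard : g.roots.card = f.natDegree := by rw [← hs.natDegree_eq_card_roots, hgd]
  have hmem (α) : α ∈ g.roots ↔ α ∈ f.rootSet L := by
    rw [mem_rootSet', mem_roots', ← hg, IsRoot.def, eval_map_algebraMap]
  have h := congrArg (algebraMap K L) (resultant_deriv (natDegree_pos_iff_degree_pos.1 hdeg))
  rw [← resultant_map_map, ← derivative_map, ← hg, ← hgd, resultant_eq_prod_eval _ _ _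
    (natDegree_derivative_le g) hs, hgm.leadingCoeff, one_pow, one_mul, hf.leadingCoeff, mul_one,
    map_mul, map_pow, map_neg, map_one] at h
  have h1 : v ((-1) ^ (g.natDegree * (g.natDegree - 1) / 2)) = 1 := by
    rw [map_pow, Valuation.map_neg, map_one, one_pow]
  have h2 := congrArg v h
  rw [map_mul, h1, one_mul] at h2
  rw [← h2, map_multiset_prod, Multiset.map_map, Multiset.map_congr rfl (g := fun _ ↦
    c ^ (f.natDegree - 1)), Multiset.map_const', Multiset.prod_replicate, hcard, ← pow_mul, mul_comm]
  intro α hα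
  rw [Function.comp_apply, hs.eval_root_derivative hgm hα, map_multiset_prod, Multiset.map_map,
    Multiset.map_congr rfl (g := fun _ ↦ c), Multiset.map_const', Multiset.prod_replicate,
    Multiset.card_erase_of_mem hα, hcard]
  · rfl
  intro β hβ
  rw [hnd.mem_erase_iff] at hβ
  exact hv α ((hmem α).1 hα) β ((hmem β).1 hβ.2) hβ.1.symm

end

/-! ### Ratios of conjugates and differences of roots -/

namespace PadicField

variable (p : ℕ) [Fact p.Prime] {K L : Type u} [Field K] [Algebra ℚ_[p] K]
  [Field L] [Algebra ℚ_[p] L] [Algebra K L] [IsScalarTower ℚ_[p] K L]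

section
variable [Algebra.IsAlgebraic ℚ_[p] K] [Algebra.IsAlgebraic ℚ_[p] L] [FiniteDimensional K L]

theorem galois_apply_mem (σ : Gal(L/K)) {x : L} (hx : x ∈ integers p L) : σ x ∈ integers p L :=
  coe_galois_smul p K L σ ⟨x, hx⟩ ▸ (σ • (⟨x, hx⟩ : integers p L)).2

/-- Conjugates have equal valuation. If instead x/σx is integral, then telescoping makes every x/σʲx
integral; applying σ with j one less than the order of σ turns this into σx/x. -/
theorem galois_apply_div_mem (σ : Gal(L/K)) (x : L) : σ x / x ∈ integers p L := by
  rcases eq_or_ne x 0 with rfl | hx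
  · simp
  rcases (integers p L).mem_or_inv_mem (σ x / x) with h | h
  · exact h
  rw [inv_div] at h
  have hj (j : ℕ) : x / (σ ^ j) x ∈ integers p L := by
    induction j with
    | zero => simp [hx]
    | succ j ih =>
      have h1 : x / (σ ^ (j + 1)) x = x / σ x * σ (x / (σ ^ j) x) := by
        rw [map_div₀, pow_succ', AlgEquiv.mul_apply]
        have : σ x ≠ 0 := by simpa using hx
        field_simp
      rw [h1]
      exact mul_mem h (galois_apply_mem p σ ih)
  have h2 := galois_apply_mem p σ (hj (orderOf σ - 1))
  rwa [map_div₀, ← AlgEquiv.mul_apply, mul_pow_sub_one (orderOf_pos σ).ne', pow_orderOf_eq_one,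
    AlgEquiv.one_apply] at h2

/-- The quotient `σ x / x`, as an element of the ring of integers. -/
def conjRatio (σ : Gal(L/K)) (x : L) : integers p L := ⟨σ x / x, galois_apply_div_mem p σ x⟩

theorem conjRatio_mul (σ τ : Gal(L/K)) {x : L} (hx : x ≠ 0) :
    conjRatio p (σ * τ) x = σ • conjRatio p τ x * conjRatio p σ x := by
  apply Subtype.ext
  have : σ x ≠ 0 := by simpa using hx
  simp only [conjRatio, MulMemClass.coe_mul, coe_galois_smul, AlgEquiv.mul_apply, map_div₀]
  field_simp

theorem residue_smul_of_mem_inertia {σ : Gal(L/K)}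
    (hσ : σ ∈ (IsLocalRing.maximalIdeal (integers p L)).inertia Gal(L/K)) (x : integers p L) :
    IsLocalRing.residue (integers p L) (σ • x) = IsLocalRing.residue (integers p L) x :=
  Ideal.Quotient.eq.2 (hσ x)

/-- The cocycle σ ↦ σx/x becomes multiplicative modulo the maximal ideal, because inertia acts
trivially on residues. -/
theorem residue_conjRatio_pow {σ : Gal(L/K)}
    (hσ : σ ∈ (IsLocalRing.maximalIdeal (integers p L)).inertia Gal(L/K)) {x : L} (hx : x ≠ 0)
    (j : ℕ) : IsLocalRing.residue (integers p L) (conjRatio p (σ ^ j) x) =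
      IsLocalRing.residue (integers p L) (conjRatio p σ x) ^ j := by
  induction j with
  | zero =>
    rw [pow_zero, pow_zero, ← map_one (IsLocalRing.residue _)]
    congr 1
    exact Subtype.ext (div_self hx)
  | succ j ih =>
    rw [pow_succ', conjRatio_mul p _ _ hx, map_mul, residue_smul_of_mem_inertia p hσ, ih, pow_succ]

/-- The residue is a p-th root of unity in characteristic p, where rᵖ - 1 = (r - 1)ᵖ. -/
theorem residue_conjRatio_eq_one {σ : Gal(L/K)}
    (hσ : σ ∈ (IsLocalRing.maximalIdeal (integers p L)).inertia Gal(L/K)) (hp : σ ^ p = 1) {x : L}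
    (hx : x ≠ 0) (j : ℕ) : IsLocalRing.residue (integers p L) (conjRatio p (σ ^ j) x) = 1 := by
  rw [residue_conjRatio_pow p hσ hx]
  have h := residue_conjRatio_pow p hσ hx p
  have h0 := residue_conjRatio_pow p hσ hx 0
  rw [hp, ← pow_zero σ, h0, pow_zero] at h
  have h1 : (IsLocalRing.residue (integers p L) (conjRatio p σ x) - 1) ^ p = 0 := by
    rw [sub_pow_char, ← h, one_pow, sub_self]
  rw [sub_eq_zero.1 (eq_zero_of_pow_eq_zero h1), one_pow]

theorem sum_conjRatio_mul (σ : Gal(L/K)) {x : L} (hx : σ x - x ≠ 0) (j : ℕ) :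
    ((∑ i ∈ Finset.range j, conjRatio p (σ ^ i) (σ x - x) : integers p L) : L) * (σ x - x) =
      (σ ^ j) x - x := by
  induction j with
  | zero => simp
  | succ j ih =>
    rw [Finset.sum_range_succ, AddMemClass.coe_add, add_mul, ih, conjRatio, div_mul_cancel₀ _ hx,
      map_sub, pow_succ, AlgEquiv.mul_apply]
    ring

variable {p} in
-- Let τ be the power of σ with τα' = β', and write α = τᵃα', β = τᵇα. Then α - β telescopes into
-- conjugates of τα - α, itself the conjugate by τᵃ of τα' - α', and ratios of conjugates are
-- integral. By symmetry all differences of distinct roots have one valuation.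
theorem root_sub_div_mem {f : K[X]} [FaithfulSMul Gal(L/K) (f.rootSet L)]
    (hp : Nat.card (f.rootSet L) = p) {σ : Gal(L/K)} (hσ : orderOf σ = p) {α β α' β' : L}
    (hα : α ∈ f.rootSet L) (hβ : β ∈ f.rootSet L) (hα' : α' ∈ f.rootSet L) (hβ' : β' ∈ f.rootSet L)
    (hne : α' ≠ β') : (α - β) / (α' - β') ∈ integers p L := by
  obtain ⟨k, -, hk⟩ := exists_pow_apply_eq hp hσ hα' hβ'
  have hτ : orderOf (σ ^ k) = p := by
    refine orderOf_eq_prime ?_ fun h ↦ hne ?_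
    · rw [← pow_mul, mul_comm, pow_mul, ← hσ, pow_orderOf_eq_one, one_pow]
    · rw [← hk, h, AlgEquiv.one_apply]
  set τ := σ ^ k
  obtain ⟨a, -, rfl⟩ := exists_pow_apply_eq hp hτ hα' hα
  obtain ⟨b, -, rfl⟩ := exists_pow_apply_eq hp hτ hα hβ
  have hδ' : τ α' - α' ≠ 0 := by rw [hk, sub_ne_zero]; exact hne.symm
  have hc : τ ((τ ^ a) α') - (τ ^ a) α' = (τ ^ a) (τ α' - α') := by
    rw [map_sub, ← AlgEquiv.mul_apply, ← AlgEquiv.mul_apply, ← pow_succ, ← pow_succ']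
  have hδ : τ ((τ ^ a) α') - (τ ^ a) α' ≠ 0 := by
    rw [hc]
    exact (_root_.map_ne_zero _).2 hδ'
  have h := sum_conjRatio_mul p τ hδ b
  rw [← hk]
  have hr : (conjRatio p (τ ^ a) (τ α' - α') : L) =
      (τ ((τ ^ a) α') - (τ ^ a) α') / (τ α' - α') := by
    rw [hc]
    rfl
  have h2 : ((τ ^ a) α' - (τ ^ b) ((τ ^ a) α')) / (α' - τ α') =
      ((∑ i ∈ Finset.range b, conjRatio p (τ ^ i) (τ ((τ ^ a) α') - (τ ^ a) α') : integers p L) : L) *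
        (conjRatio p (τ ^ a) (τ α' - α') : integers p L) := by
    rw [hr, ← mul_div_assoc, h, ← neg_sub, ← neg_sub (τ α'), neg_div_neg_eq]
  rw [h2]
  exact mul_mem (SetLike.coe_mem _) (SetLike.coe_mem _)

end

section
variable [FiniteDimensional ℚ_[p] K] [FiniteDimensional ℚ_[p] L]

theorem valuation_le_of_div_mem {x y : L} (hy : y ≠ 0) (h : x / y ∈ integers p L) :
    (IsDiscreteValuationRing.maximalIdeal (integers p L)).valuation L x ≤
      (IsDiscreteValuationRing.maximalIdeal (integers p L)).valuation L y := by
  have h1 := (IsDiscreteValuationRing.maximalIdeal (integers p L)).valuation_le_one (K := L) ⟨_, h⟩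
  have h2 : x = x / y * y := (div_mul_cancel₀ x hy).symm
  rw [h2, map_mul]
  exact mul_le_of_le_one_left' h1

variable {p} in
theorem normalizedVal_discr [FiniteDimensional K L] {f : K[X]} (hf : f.Monic) (hsep : f.Separable)
    (hdeg : f.natDegree = p)
    (hs : (f.map (algebraMap K L)).Splits) [FaithfulSMul Gal(L/K) (f.rootSet L)]
    {σ : Gal(L/K)} (hσ : orderOf σ = p) {α β : L}
    (hα : α ∈ f.rootSet L) (hβ : β ∈ f.rootSet L) (hne : α ≠ β) :
    normalizedVal p L (algebraMap K L f.discr) = p * (p - 1) * normalizedVal p L (β - α) := by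
  have hp : (Nat.card (f.rootSet L)) = p := by
    rw [Nat.card_eq_fintype_card, card_rootSet_eq_natDegree hsep hs, hdeg]
  have hpos : 0 < p := (Fact.out : p.Prime).pos
  rw [normalizedVal, valuation_discr _ hf (hdeg ▸ hpos) hs hsep
    ((IsDiscreteValuationRing.maximalIdeal (integers p L)).valuation L (β - α)), WithZero.log_pow,
    hdeg, normalizedVal, nsmul_eq_mul, mul_neg]
  · push_cast [Nat.cast_sub hpos]
    ring
  · intro x hx y hy hxy
    exact le_antisymm
      (valuation_le_of_div_mem p (sub_ne_zero.2 hne.symm) (root_sub_div_mem hp hσ hx hy hβ hα hne.symm))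
      (valuation_le_of_div_mem p (sub_ne_zero.2 hxy) (root_sub_div_mem hp hσ hβ hα hx hy hxy))

end

end PadicField

/-! ### Normalised roots modulo the maximal ideal -/

namespace PadicField

variable (p : ℕ) [Fact p.Prime] {K L : Type u} [Field K] [Algebra ℚ_[p] K]
  [Field L] [Algebra ℚ_[p] L] [Algebra K L] [IsScalarTower ℚ_[p] K L]

section
variable [Algebra.IsAlgebraic ℚ_[p] K] [Algebra.IsAlgebraic ℚ_[p] L] [FiniteDimensional K L]

theorem smul_mem_maximalIdeal (σ : Gal(L/K)) {x : integers p L}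
    (hx : x ∈ IsLocalRing.maximalIdeal (integers p L)) :
    σ • x ∈ IsLocalRing.maximalIdeal (integers p L) := by
  rw [IsLocalRing.mem_maximalIdeal, mem_nonunits_iff] at hx ⊢
  exact fun h ↦ hx ((isUnit_map_iff (MulSemiringAction.toRingEquiv Gal(L/K) (integers p L) σ) x).1 h)

instance : ((IsLocalRing.maximalIdeal (integers p L)).inertia Gal(L/K)).Normal := by
  refine ⟨fun σ hσ τ x ↦ ?_⟩
  have h := smul_mem_maximalIdeal p τ (hσ (τ⁻¹ • x))
  rwa [smul_sub, smul_smul, smul_smul, smul_inv_smul] at h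

/-- The Galois group may move residues, but it fixes the prime field. -/
theorem residue_smul_eq_natCast (τ : Gal(L/K)) {x : integers p L} {n : ℕ}
    (hx : IsLocalRing.residue (integers p L) x = n) :
    IsLocalRing.residue (integers p L) (τ • x) = n := by
  have h1 (y : integers p L) : IsLocalRing.residue (integers p L) y = n ↔
      y - n ∈ IsLocalRing.maximalIdeal (integers p L) := by
    rw [← map_natCast (IsLocalRing.residue (integers p L))]
    exact Ideal.Quotient.eq
  rw [h1] at hx ⊢
  have := smul_mem_maximalIdeal p τ hx
  rwa [smul_sub, show τ • (n : integers p L) = n from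
    map_natCast (MulSemiringAction.toRingHom Gal(L/K) (integers p L) τ) n] at this

/-- The normalised roots `(σ ^ j α - α) / (σ α - α)`. -/
def normalizedRoot (σ : Gal(L/K)) (α : L) (j : ℕ) : integers p L :=
  ∑ i ∈ Finset.range j, conjRatio p (σ ^ i) (σ α - α)

variable {p} in
theorem normalizedRoot_mul_add {σ : Gal(L/K)} {α : L} (hα : σ α ≠ α) (j : ℕ) :
    (σ α - α) * (normalizedRoot p σ α j : L) + α = (σ ^ j) α := by
  have := sum_conjRatio_mul p σ (sub_ne_zero.2 hα) j
  rw [normalizedRoot, mul_comm, this, sub_add_cancel]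

variable {p} in
theorem residue_normalizedRoot {σ : Gal(L/K)}
    (hσ : σ ∈ (IsLocalRing.maximalIdeal (integers p L)).inertia Gal(L/K)) (hp : σ ^ p = 1) {α : L}
    (hα : σ α ≠ α) (j : ℕ) :
    IsLocalRing.residue (integers p L) (normalizedRoot p σ α j) = j := by
  rw [normalizedRoot, map_sum, Finset.sum_congr rfl fun i _ ↦
    residue_conjRatio_eq_one p hσ hp (sub_ne_zero.2 hα) i]
  simp

section
variable {p} {f : K[X]} {σ : Gal(L/K)}
  (hσ : σ ∈ (IsLocalRing.maximalIdeal (integers p L)).inertia Gal(L/K)) (hp : orderOf σ = p)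
  [FaithfulSMul Gal(L/K) (f.rootSet L)] (hcard : Nat.card (f.rootSet L) = p) {α : L}
  (hα : α ∈ f.rootSet L) (hne : σ α ≠ α)

include hσ hp hne in
-- Equal conjugates would give equal normalised roots, but these have the distinct residues 0, …,
-- p-1.
theorem pow_apply_injOn : Set.InjOn (fun j : ℕ ↦ (σ ^ j) α) (Finset.range p) := by
  intro i hi j hj hij
  have hp' : σ ^ p = 1 := hp ▸ pow_orderOf_eq_one σ
  have h : normalizedRoot p σ α i = normalizedRoot p σ α j := by
    have h1 := normalizedRoot_mul_add (p := p) hne i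
    simp only at hij
    rw [hij, ← normalizedRoot_mul_add (p := p) hne j, add_left_inj] at h1
    exact Subtype.ext (mul_left_cancel₀ (sub_ne_zero.2 hne) h1)
  refine natCast_injOn_range (residueField p L) p hi hj ?_
  simp only
  rw [← residue_normalizedRoot hσ hp' hne, h, residue_normalizedRoot hσ hp' hne]

include hσ hp hcard hα hne in
-- Fixing α and σα, the automorphism `τ` permutes the normalised roots and preserves their residues,
-- which lie in the prime field and tell the roots apart. So `τ` fixes every root.
theorem eq_one_of_apply_eq {τ : Gal(L/K)} (h1 : τ α = α) (h2 : τ (σ α) = σ α) : τ = 1 := by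
  refine FaithfulSMul.eq_of_smul_eq_smul (α := f.rootSet L) fun β ↦ Subtype.ext ?_
  rw [one_smul]
  obtain ⟨j, hj, hjβ⟩ := exists_pow_apply_eq hcard hp hα β.2
  obtain ⟨k, hk, hkβ⟩ := exists_pow_apply_eq hcard hp hα (τ • β).2
  have hp' : σ ^ p = 1 := hp ▸ pow_orderOf_eq_one σ
  have h : τ • normalizedRoot p σ α j = normalizedRoot p σ α k := by
    have h3 : (τ • β : f.rootSet L) = τ ((σ ^ j) α) := congrArg τ hjβ.symm
    rw [h3, ← normalizedRoot_mul_add (p := p) hne k, ← normalizedRoot_mul_add (p := p) hne j, map_add, map_mul,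
      map_sub, h1, h2, add_left_inj] at hkβ
    refine Subtype.ext ?_
    rw [coe_galois_smul]
    exact (mul_left_cancel₀ (sub_ne_zero.2 hne) hkβ).symm
  have hjk : j = k := by
    refine natCast_injOn_range (residueField p L) p (by simpa using hj) (by simpa using hk) ?_
    have h4 := residue_smul_eq_natCast p τ (residue_normalizedRoot hσ hp' hne j)
    rw [h, residue_normalizedRoot hσ hp' hne] at h4
    exact h4.symm
  rw [← hkβ, ← hjk, hjβ]

include hσ hp hcard hα hne in
-- An automorphism is determined by the images of α and σα, an ordered pair of distinct roots.
theorem card_galois_le : Nat.card Gal(L/K) ≤ p * (p - 1) := by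
  classical
  have : Finite (f.rootSet L) := inferInstance
  have hβ : σ α ∈ f.rootSet L := smul_mem_rootSet σ hα
  have h := Finset.card_le_card_of_injOn (s := (Finset.univ : Finset Gal(L/K)))
    (t := (Finset.univ : Finset (f.rootSet L)).offDiag)
    (fun τ ↦ (τ • ⟨α, hα⟩, τ • ⟨σ α, hβ⟩)) (fun τ _ ↦ by
      simp only [Finset.coe_offDiag, Set.mem_offDiag, Finset.coe_univ, Set.mem_univ, true_and]
      exact fun h ↦ hne (congrArg Subtype.val (MulAction.injective τ h)).symm) (by
      intro τ _ τ' _ h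
      obtain ⟨h1, h2⟩ := Prod.ext_iff.1 h
      have h3 : τ'⁻¹ * τ = 1 := by
        refine eq_one_of_apply_eq hσ hp hcard hα hne ?_ ?_
        · have := (inv_smul_eq_iff (g := τ')).2 (congrArg Subtype.val h1)
          exact this
        · have := (inv_smul_eq_iff (g := τ')).2 (congrArg Subtype.val h2)
          exact this
      exact (inv_mul_eq_one.1 h3).symm)
  rw [Finset.offDiag_card, Finset.card_univ, Finset.card_univ, ← Nat.card_eq_fintype_card,
    ← Nat.card_eq_fintype_card, hcard] at h
  rwa [Nat.mul_sub_one]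

variable (p σ α) in
/-- The monic polynomial whose roots are the normalised roots. -/
def normalizedPoly : (integers p L)[X] :=
  ∏ j ∈ Finset.range p, (X - C (normalizedRoot p σ α j))

theorem monic_normalizedPoly : (normalizedPoly p σ α).Monic :=
  monic_prod_of_monic _ _ fun _ _ ↦ monic_X_sub_C _

theorem natDegree_normalizedPoly : (normalizedPoly p σ α).natDegree = p := by
  rw [normalizedPoly, natDegree_prod_of_monic _ _ fun _ _ ↦ monic_X_sub_C _]
  simp

include hσ hp hne in
theorem map_residue_normalizedPoly :
    (normalizedPoly p σ α).map (IsLocalRing.residue (integers p L)) = X ^ p - X := by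
  have hp' : σ ^ p = 1 := hp ▸ pow_orderOf_eq_one σ
  rw [normalizedPoly, Polynomial.map_prod, X_pow_sub_X_eq_prod]
  refine Finset.prod_congr rfl fun j _ ↦ ?_
  rw [Polynomial.map_sub, map_X, map_C, residue_normalizedRoot hσ hp' hne]

omit [FaithfulSMul Gal(L/K) (f.rootSet L)] in
include hσ hp hα hne in
-- The substitution carries the j-th normalised root to σʲα, and each of the p linear factors
-- contributes one σα - α.
theorem comp_eq_normalizedPoly (hf : f.Monic) (hdeg : f.natDegree = p) :
    (f.map (algebraMap K L)).comp (C (σ α - α) * X + C α) =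
      C ((σ α - α) ^ p) * (normalizedPoly p σ α).map (integers p L).subtype := by
  have h : f.map (algebraMap K L) = ∏ j ∈ Finset.range p, (X - C ((σ ^ j) α)) := by
    refine eq_prod_X_sub_C_of_injOn (hf.map _) _ _ (pow_apply_injOn hσ hp hne) (fun j _ ↦ ?_) ?_
    · rw [IsRoot.def, eval_map_algebraMap]
      exact aeval_eq_zero_of_mem_rootSet (smul_mem_rootSet (σ ^ j) hα)
    · rw [natDegree_map, hdeg, Finset.card_range]
  rw [h, Polynomial.prod_comp, normalizedPoly, Polynomial.map_prod]
  have h1 : (C ((σ α - α) ^ p) : L[X]) = ∏ j ∈ Finset.range p, C (σ α - α) := by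
    rw [Finset.prod_const, Finset.card_range, C_pow]
  rw [h1, ← Finset.prod_mul_distrib]
  refine Finset.prod_congr rfl fun j _ ↦ ?_
  rw [sub_comp, X_comp, C_comp, ← normalizedRoot_mul_add (p := p) hne j, Polynomial.map_sub, map_X, map_C,
    C_add, C_mul]
  change _ = C (σ α - α) * (X - C (normalizedRoot p σ α j : L))
  ring

end

end

end PadicField

/-! ### Inertia and total ramification -/

namespace PadicField

variable {p : ℕ} [Fact p.Prime] {K : Type u} [Field K] [Algebra ℚ_[p] K] [FiniteDimensional ℚ_[p] K]

theorem ramificationIndex_pos (L : Type u) [Field L] [Algebra ℚ_[p] L] [Algebra K L]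
    [IsScalarTower ℚ_[p] K L] [FiniteDimensional ℚ_[p] L] : 0 < ramificationIndex p K L := by
  have : FiniteDimensional K L := .right ℚ_[p] K L
  obtain ⟨f, hf, -⟩ := exists_ramificationIndex_mul_eq_finrank p K L
  exact Nat.pos_of_ne_zero fun h ↦ by simp [h, Module.finrank_pos.ne] at hf

/-- The hypothesis on the discriminant forces ramification, and primitivity of the action on the
roots upgrades any ramification to wild ramification. -/
theorem exists_mem_inertia_of_isCoprime (hp : Odd p) {L : Type u} [Field L] [Algebra ℚ_[p] L]
    [Algebra K L] [IsScalarTower ℚ_[p] K L] [FiniteDimensional ℚ_[p] L] [FiniteDimensional K L]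
    [IsGalois K L] {f : K[X]}
    (hf : f.Monic) (hdeg : f.natDegree = p) (hirr : Irreducible f)
    (hs : (f.map (algebraMap K L)).Splits) [FaithfulSMul Gal(L/K) (f.rootSet L)]
    (hcard : Nat.card (f.rootSet L) = p)
    (hdisc : IsCoprime (normalizedVal p K f.discr) ((p : ℤ) - 1)) {α β : L}
    (hα : α ∈ f.rootSet L) (hβ : β ∈ f.rootSet L) (hne : α ≠ β) :
    normalizedVal p L (algebraMap K L f.discr) = p * (p - 1) * normalizedVal p L (β - α) ∧
    p ∣ ramificationIndex p K L ∧
    ∃ σ ∈ (IsLocalRing.maximalIdeal (integers p L)).inertia Gal(L/K),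
      orderOf σ = p ∧ σ α = β := by
  have hprime : (Nat.card (f.rootSet L)).Prime := hcard ▸ Fact.out
  have : CharZero K := charZero_of_injective_algebraMap (algebraMap ℚ_[p] K).injective
  have hirr' : Fact (Irreducible f) := ⟨hirr⟩
  have hne' : Nonempty (f.rootSet L) := ⟨⟨α, hα⟩⟩
  obtain ⟨τ, hτ⟩ : ∃ τ : Gal(L/K), orderOf τ = p :=
    exists_prime_orderOf_dvd_card' p (by
      have := MulAction.IsPretransitive.card_dvd (G := Gal(L/K)) (X := f.rootSet L)
      rwa [hcard] at this)
  have hval := normalizedVal_discr hf hirr.separable hdeg hs hτ hα hβ hne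
  have hcardI := card_inertia_eq_ramificationIndex p K L
  -- Compute v_L(Δ) in two ways, as e · v_K(Δ) and as a multiple of p-1, and cancel v_K(Δ).
  have hdvd : (p : ℤ) - 1 ∣ ramificationIndex p K L := by
    refine hdisc.symm.dvd_of_dvd_mul_right ?_
    rw [← normalizedVal_algebraMap, hval, mul_right_comm]
    exact dvd_mul_left _ _
  have hp3 : 3 ≤ p := by
    have := (Fact.out : p.Prime).two_le
    obtain ⟨k, rfl⟩ := hp
    lia
  -- With trivial inertia e = 1, and p-1 ≥ 2 cannot divide 1; this is where p = 2 would fail.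
  have hI : (IsLocalRing.maximalIdeal (integers p L)).inertia Gal(L/K) ≠ ⊥ := by
    intro h
    rw [h, Subgroup.card_bot] at hcardI
    rw [← hcardI] at hdvd
    have := Int.le_of_dvd (by norm_num) hdvd
    push_cast at this
    lia
  have hpI := prime_dvd_card_of_normal hprime _ hI
  rw [hcard] at hpI
  refine ⟨hval, hcardI ▸ hpI, ?_⟩
  obtain ⟨σ, hσ⟩ := exists_prime_orderOf_dvd_card' p hpI
  have hσ' : orderOf (σ : Gal(L/K)) = p := (Subgroup.orderOf_coe σ).trans hσ
  obtain ⟨j, -, hj⟩ := exists_pow_apply_eq hcard hσ' hα hβ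
  have hone : (σ : Gal(L/K)) ^ p = 1 := by
    have := pow_orderOf_eq_one (σ : Gal(L/K))
    rwa [hσ'] at this
  -- A power of σ taking α to β is not the identity, so it again has order p.
  refine ⟨σ ^ j, pow_mem σ.2 j, orderOf_eq_prime ?_ fun h ↦ hne ?_, hj⟩
  · rw [← pow_mul, mul_comm, pow_mul, hone, one_pow]
  · rw [← hj, h, AlgEquiv.one_apply]

section
variable {F : Type u} [Field F] [Algebra ℚ_[p] F] [FiniteDimensional ℚ_[p] F] [Algebra K F]
  [IsScalarTower ℚ_[p] K F]

/-- The arithmetic of the extension generated by the roots of `f` and a square root of the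
difference of two of them. -/
theorem exists_normalizedPoly (hp : Odd p) {f : K[X]}
    (hf : f.Monic) (hdeg : f.natDegree = p) (hirr : Irreducible f)
    (hdisc : IsCoprime (normalizedVal p K f.discr) ((p : ℤ) - 1))
    (hs : (f.map (algebraMap K F)).Splits) {α β s : F}
    (hα : α ∈ f.rootSet F) (hβ : β ∈ f.rootSet F) (hne : α ≠ β) (hsq : s ^ 2 = β - α)
    (htop : IntermediateField.adjoin K (f.rootSet F ∪ {s}) = ⊤) :
    Function.Bijective (residueFieldMap p K F) ∧
    ∃ g : (integers p F)[X], g.Monic ∧ g.natDegree = p ∧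
      g.map (IsLocalRing.residue (integers p F)) = X ^ p - X ∧
      (f.map (algebraMap K F)).comp (C (β - α) * X + C α) =
        C ((β - α) ^ p) * g.map (integers p F).subtype := by
  have hprime : p.Prime := Fact.out
  have : CharZero K := charZero_of_injective_algebraMap (algebraMap ℚ_[p] K).injective
  have : FiniteDimensional K F := .right ℚ_[p] K F
  let L : IntermediateField K F := IntermediateField.adjoin K (f.rootSet F)
  have : FiniteDimensional ℚ_[p] L := .trans ℚ_[p] K L
  have : IsScalarTower ℚ_[p] L F := IsScalarTower.of_algebraMap_eq fun x ↦ by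
    rw [IsScalarTower.algebraMap_apply ℚ_[p] K L, ← IsScalarTower.algebraMap_apply K L F,
      ← IsScalarTower.algebraMap_apply ℚ_[p] K F]
  have hmem {x : F} (hx : x ∈ f.rootSet F) : x ∈ L := IntermediateField.subset_adjoin _ _ hx
  have hLsplit : f.IsSplittingField K L := IntermediateField.adjoin_rootSet_isSplittingField hs
  have hLs : (f.map (algebraMap K L)).Splits := hLsplit.splits
  have : IsGalois K L := IsGalois.of_separable_splitting_field hirr.separable
  have htopL : IntermediateField.adjoin K (f.rootSet L) = ⊤ :=
    (isSplittingField_iff_intermediateField.1 hLsplit).2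
  have := faithfulSMul_rootSet htopL
  have hcard : Nat.card (f.rootSet L) = p := by
    rw [Nat.card_eq_fintype_card, card_rootSet_eq_natDegree hirr.separable hLs, hdeg]
  let a : L := ⟨α, hmem hα⟩
  let b : L := ⟨β, hmem hβ⟩
  have hmemL {x : L} (hx : (x : F) ∈ f.rootSet F) : x ∈ f.rootSet L := by
    rw [mem_rootSet'] at hx ⊢
    refine ⟨(hf.map _).ne_zero, (algebraMap L F).injective ?_⟩
    rw [← Polynomial.aeval_algebraMap_apply, map_zero]
    exact hx.2
  have hab : a ≠ b := fun h ↦ hne (congrArg Subtype.val h)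
  obtain ⟨hval, hdvd, σ, hσ, hord, hσa⟩ := exists_mem_inertia_of_isCoprime hp hf hdeg hirr hLs
    hcard hdisc (hmemL hα : a ∈ f.rootSet L) (hmemL hβ : b ∈ f.rootSet L) hab
  have hσne : σ a ≠ a := hσa ▸ hab.symm
  constructor
  · obtain ⟨r, hr, hbij⟩ := exists_ramificationIndex_mul_eq_finrank p K F
    refine hbij ?_
    have h1 : Module.finrank K L ≤ p * (p - 1) := by
      rw [← IsGalois.card_aut_eq_finrank]
      exact card_galois_le hσ hord hcard (hmemL hα) hσne
    have h2 : Module.finrank L F ≤ 2 := by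
      have htop' : IntermediateField.adjoin L {s} = ⊤ := by
        apply IntermediateField.restrictScalars_injective K
        rw [IntermediateField.adjoin_adjoin_left, htop, IntermediateField.restrictScalars_top]
      have hroot : aeval s (X ^ 2 - C (b - a)) = 0 := by
        rw [map_sub, map_pow, aeval_X, aeval_C, hsq, map_sub]
        exact sub_self _
      rw [← IntermediateField.finrank_top', ← htop',
        IntermediateField.adjoin.finrank (Algebra.IsIntegral.isIntegral s)]
      refine (natDegree_le_of_dvd (minpoly.dvd L s hroot)
        (monic_X_pow_sub_C _ two_ne_zero).ne_zero).trans ?_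
      rw [natDegree_X_pow_sub_C]
    have h3 : Module.finrank K F ≤ 2 * (p * (p - 1)) := by
      rw [← Module.finrank_mul_finrank K L F, mul_comm]
      exact Nat.mul_le_mul h2 h1
    have h4 : p ∣ ramificationIndex p K F := by
      rw [← ramificationIndex_tower p K L F]
      exact hdvd.mul_right _
    have hs0 : s ≠ 0 := by
      rintro rfl
      exact hne (sub_eq_zero.1 (by rw [← hsq]; simp)).symm
    have h5 : normalizedVal p F (β - α) = 2 * normalizedVal p F s := by
      rw [← hsq, normalizedVal, map_pow, WithZero.log_pow, normalizedVal, nsmul_eq_mul, mul_neg]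
      rfl
    have h6 : 2 * ((p : ℤ) - 1) ∣ ramificationIndex p K F := by
      have heven : (2 : ℤ) ∣ p - 1 := by
        obtain ⟨k, rfl⟩ := hp
        exact ⟨k, by push_cast; ring⟩
      -- As p-1 is even, being prime to p-1 already gives being prime to 2; the square root thus
      -- contributes a further factor 2 to e.
      have h7 : IsCoprime (normalizedVal p K f.discr) (2 * ((p : ℤ) - 1)) :=
        (hdisc.of_isCoprime_of_dvd_right heven).mul_right hdisc
      refine h7.symm.dvd_of_dvd_mul_right ?_
      have h8 : normalizedVal p F (algebraMap K F f.discr) =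
          p * (p - 1) * normalizedVal p F (β - α) := by
        rw [IsScalarTower.algebraMap_apply K L F, normalizedVal_algebraMap, hval, mul_left_comm,
          ← normalizedVal_algebraMap]
        rfl
      rw [← normalizedVal_algebraMap, h8, h5]
      exact ⟨p * normalizedVal p F s, by ring⟩
    have h7 : 2 * (p - 1) ∣ ramificationIndex p K F := by
      have : ((2 * (p - 1) : ℕ) : ℤ) = 2 * ((p : ℤ) - 1) := by
        push_cast [Nat.cast_sub hprime.one_lt.le]
        ring
      rw [← Int.natCast_dvd_natCast, this]
      exact h6
    have h8 : Nat.Coprime p (2 * (p - 1)) := by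
      refine Nat.Coprime.mul_right ?_ ?_
      · exact Nat.coprime_two_right.2 hp
      · exact (Nat.coprime_self_sub_right hprime.one_lt.le).2 (Nat.coprime_one_right p)
    -- Thus e ≥ 2p(p-1), while e · r = [F:K] ≤ 2p(p-1); so the residue degree `r` is 1.
    have h9 := Nat.le_of_dvd (ramificationIndex_pos F) (h8.mul_dvd_of_dvd_of_dvd h4 h7)
    have h10 : 0 < Module.finrank K F := Module.finrank_pos
    have h11 := ramificationIndex_pos (p := p) (K := K) F
    have h12 : ramificationIndex p K F * r ≤ ramificationIndex p K F * 1 := by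
      rw [hr]
      calc _ ≤ _ := h3
        _ = p * (2 * (p - 1)) := by ring
        _ ≤ _ := by rw [mul_one]; exact h9
    have h13 := Nat.le_of_mul_le_mul_left h12 h11
    have h14 : r ≠ 0 := by
      rintro rfl
      lia
    lia
  -- The polynomial is built over L, where σ acts, and only then extended to F.
  · refine ⟨(normalizedPoly p σ a).map (integersMap p L F), monic_normalizedPoly.map _, ?_, ?_, ?_⟩
    · rw [monic_normalizedPoly.natDegree_map, natDegree_normalizedPoly]
    · have h1 := congrArg (Polynomial.map (residueFieldMap p L F))
        (map_residue_normalizedPoly hσ hord hσne)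
      rw [Polynomial.map_map] at h1 ⊢
      rw [Polynomial.map_sub, Polynomial.map_pow, map_X] at h1
      exact h1
    · have h1 := congrArg (Polynomial.map (algebraMap L F))
        (comp_eq_normalizedPoly hσ hord (hmemL hα) hσne hf hdeg)
      rw [hσa, Polynomial.map_comp, Polynomial.map_map, ← IsScalarTower.algebraMap_eq,
        Polynomial.map_add, Polynomial.map_mul, Polynomial.map_mul, map_X, map_C, map_C, map_C,
        Polynomial.map_map] at h1
      rw [Polynomial.map_map]
      exact h1

end

end PadicField

/-! ### The field F inside the algebraic closure -/

namespace PadicField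

variable {K : Type u} [Field K] {f : K[X]} {s : AlgebraicClosure K}

instance : FiniteDimensional K (rootField f s) := by
  have : Finite ↑(f.rootSet (AlgebraicClosure K) ∪ {s}) :=
    ((f.rootSet_finite _).union (Set.finite_singleton s)).to_subtype
  exact IntermediateField.finiteDimensional_adjoin fun x _ ↦ Algebra.IsIntegral.isIntegral x

theorem mem_rootSet_rootField {x : rootField f s} :
    x ∈ f.rootSet (rootField f s) ↔ (x : AlgebraicClosure K) ∈ f.rootSet (AlgebraicClosure K) := by
  rw [mem_rootSet, mem_rootSet]
  refine and_congr_right fun _ ↦ ?_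
  rw [show (x : AlgebraicClosure K) = algebraMap (rootField f s) (AlgebraicClosure K) x from rfl,
    Polynomial.aeval_algebraMap_apply]
  simp

theorem splits_rootField : (f.map (algebraMap K (rootField f s))).Splits := by
  refine IntermediateField.splits_of_splits (IsAlgClosed.splits _) fun x hx ↦ ?_
  exact mem_rootField_of_mem_rootSet hx

theorem adjoin_rootField_eq_top :
    IntermediateField.adjoin K (f.rootSet (rootField f s) ∪ {⟨s, mem_rootField_self f s⟩}) =
      (⊤ : IntermediateField K (rootField f s)) := by
  apply IntermediateField.map_injective (rootField f s).val
  rw [IntermediateField.adjoin_map, ← AlgHom.fieldRange_eq_map, IntermediateField.fieldRange_val]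
  refine congrArg (IntermediateField.adjoin K) ?_
  ext x
  constructor
  · rintro ⟨y, hy | rfl, rfl⟩
    · exact Or.inl (mem_rootSet_rootField.1 hy)
    · exact Or.inr rfl
  · rintro (hx | rfl)
    · exact ⟨⟨x, mem_rootField_of_mem_rootSet hx⟩, Or.inl (mem_rootSet_rootField.2 hx), rfl⟩
    · exact ⟨_, Or.inr rfl, rfl⟩

end PadicField

end

theorem lemma4p1 (p : ℕ) [Fact p.Prime] (hp : Odd p)
    (K : Type u) [Field K] [Algebra ℚ_[p] K] [FiniteDimensional ℚ_[p] K]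
    (f : K[X]) (hf : f.Monic) (hdeg : f.natDegree = p) (hirr : Irreducible f)
    (hdisc : IsCoprime (PadicField.normalizedVal p K f.discr) ((p : ℤ) - 1))
    (α₁ α₂ s : AlgebraicClosure K)
    (hα₁ : α₁ ∈ f.rootSet (AlgebraicClosure K)) (hα₂ : α₂ ∈ f.rootSet (AlgebraicClosure K))
    (hne : α₁ ≠ α₂) (hs : s ^ 2 = α₂ - α₁) :
    let F := PadicField.rootField f s
    let a₁ : F := ⟨α₁, PadicField.mem_rootField_of_mem_rootSet hα₁⟩
    let a₂ : F := ⟨α₂, PadicField.mem_rootField_of_mem_rootSet hα₂⟩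
    let t : F := ⟨s, PadicField.mem_rootField_self f s⟩
    let O := PadicField.integers p F
    let k := PadicField.residueField p F
    let fF : F[X] := f.map (algebraMap K F)
    -- the residue field of `F` is that of `K`
    Function.Bijective (PadicField.residueFieldMap p K F) ∧
    ∃ g : O[X],
      let gF : F[X] := g.map O.subtype
      g.Monic ∧ g.natDegree = p ∧
      -- the equation `y² = g(x)` reduces to `y² = x ^ p - x`
      g.map (IsLocalRing.residue O) = (X ^ p - X : k[X]) ∧
      -- the complete curve `y² = g(x)` over `O` is an integral model of `X ×_K F` ...
      (∃ M : Hyperelliptic.IntegralModel O.subtype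
          (Hyperelliptic.baseChangeStr (algebraMap K F) f) (Hyperelliptic.curveStr g),
        -- ... through the substitution `x ↦ (α₂ - α₁) x + α₁`, `y ↦ √(α₂ - α₁) ^ p y`
        ∃ ψ : Hyperelliptic.CoordRing fF →+* Hyperelliptic.CoordRing gF,
          (∀ c : F, ψ (algebraMap F (Hyperelliptic.CoordRing fF) c) =
            algebraMap F (Hyperelliptic.CoordRing gF) c) ∧
          ψ (Hyperelliptic.coordX fF) =
            algebraMap F (Hyperelliptic.CoordRing gF) (a₂ - a₁) * Hyperelliptic.coordX gF +
              algebraMap F (Hyperelliptic.CoordRing gF) a₁ ∧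
          ψ (Hyperelliptic.coordY fF) =
            algebraMap F (Hyperelliptic.CoordRing gF) (t ^ p) * Hyperelliptic.coordY gF ∧
          Hyperelliptic.affineToBaseChange O.subtype g ≫ M.genericIso.hom =
            Spec.map (CommRingCat.ofHom ψ) ≫
              Hyperelliptic.affineToBaseChange (algebraMap K F) f) ∧
      -- its special fibre is the complete curve `y² = x ^ p - x` over the residue field
      ∃ e : Hyperelliptic.baseChange (IsLocalRing.residue O) g ≅
          Hyperelliptic.curve (X ^ p - X : k[X]),
        e.hom ≫ Hyperelliptic.curveStr (X ^ p - X : k[X]) =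
          Hyperelliptic.baseChangeStr (IsLocalRing.residue O) g := by
  intro F a₁ a₂ t O k fF
  have : FiniteDimensional ℚ_[p] F := .trans ℚ_[p] K F
  obtain ⟨hbij, g, hg, hgdeg, hgred, hsub⟩ := PadicField.exists_normalizedPoly hp hf hdeg
    hirr hdisc PadicField.splits_rootField (α := a₁) (β := a₂) (s := t)
    (PadicField.mem_rootSet_rootField.2 hα₁) (PadicField.mem_rootSet_rootField.2 hα₂)
    (fun h ↦ hne (congrArg Subtype.val h)) (Subtype.ext hs) PadicField.adjoin_rootField_eq_top
  have ht : t ^ 2 = a₂ - a₁ := Subtype.ext hs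
  have ha : a₂ - a₁ ≠ 0 := sub_ne_zero.2 fun h ↦ hne (congrArg Subtype.val h).symm
  have hc : t ^ p ≠ 0 := pow_ne_zero _ fun h ↦ ha (by rw [← ht, h, zero_pow two_ne_zero])
  have hgen : ∀ {A B : Type u} [CommRing A] [CommRing B] [Nontrivial B] (φ : A →+* B) (q : A[X]),
      q.Monic → Hyperelliptic.genus (q.map φ) = Hyperelliptic.genus q := by
    intro A B _ _ _ φ q hq
    rw [Hyperelliptic.genus, Hyperelliptic.genus, hq.natDegree_map]
  -- The scaling c of y must satisfy c² = (α₂ - α₁)ᵖ, hence c = tᵖ.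
  have hsub' : (f.map (algebraMap K F)).comp (C (a₂ - a₁) * X + C a₁) =
      C ((t ^ p) ^ 2) * g.map O.subtype := by
    rw [hsub, ← ht, ← pow_mul, ← pow_mul, mul_comm p 2]
  refine ⟨hbij, g, hg, hgdeg, hgred, ?_, ?_⟩
  · obtain ⟨M, hM⟩ := Hyperelliptic.exists_integralModel O.subtype (algebraMap K F) f g (a₂ - a₁)
      a₁ (t ^ p) ha hc (hgen _ f hf) (hgen _ g hg) (by
        rw [hgen _ f hf, hgen _ g hg, Hyperelliptic.genus, Hyperelliptic.genus, hdeg, hgdeg]) hsub'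
    exact ⟨M, _, Hyperelliptic.substitution_algebraMap _ _ _ _ _ _,
      Hyperelliptic.substitution_coordX _ _ _ _ _ _,
      Hyperelliptic.substitution_coordY _ _ _ _ _ _, hM⟩
  · exact Hyperelliptic.exists_baseChangeIso (IsLocalRing.residue O) g _ hgred (hgen _ g hg)
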